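/- **Setting.** A *beam frame* in $\mathbb R^3$ has vertices $V$ (points of $\mathbb R^3$) and a finite set $E$ of edges. Each edge $e$ is a straight beam of length $\ell_e>0$ from an origin vertex to a terminus vertex, parametrized by arc length $x\in(0,\ell_e)$, with a right-handed orthonormal basis $\{\vec i_e,\vec j_e,\vec k_e\}$ ($\vec i_e=\vec j_e\times\vec k_e$) such that $\vec i_e$ points from origin to terminus, and with constants $a_e,b_e,c_e,d_e>0$. Write $e\sim\mathfrak v$ if $\mathfrak v$ is an end of $e$, and $s^e_{\mathfrak v}=1$ (resp. $-1$) if $\mathfrak v$ is the origin (resp. terminus) of $e$. Let $L^2(\Gamma)=\bigoplus_{e}L^2(0,\ell_e)^4$ (complex-valued), with elements $\Psi=(v,w,u,\eta)$. All functions and derivatives in vertex conditions are evaluated at the end $\mathfrak v$ of the edge, and derivatives are with respect to $x$. The *energy form* with free rigid joints is $$h[\widetilde\Psi,\Psi]=\sum_{e\in E}\int_0^{\ell_e}\big(a_e\overline{\widetilde v_e''}v_e''+b_e\overline{\widetilde w_e''}w_e''+c_e\overline{\widetilde u_e'}u_e'+d_e\overline{\widetilde\eta_e'}\eta_e'\big)\,dx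 ,$$ with domain the $\Psi$ such that $v_e,w_e\in H^2(0,\ell_e)$, $u_e,\eta_e\in H^1(0,\ell_e)$ for all $e$ and, at every vertex $\mathfrak v$, the vectors $u_e\vec i_e+w_e\vec j_e+v_e\vec k_e$ agree for all $e\sim\mathfrak v$, and the vectors $\eta_e\vec i_e-v_e'\vec j_e+w_e'\vec k_e$ agree for all $e\sim\mathfrak v$. The *Hamiltonian* of the frame is the self-adjoint operator $H$ on $L^2(\Gamma)$ with $\mathrm{Dom}(H)\subset\mathrm{Dom}(h)$ and $h[\widetilde\Psi,\Psi]=\langle\widetilde\Psi,H\Psi\rangle$ for all $\widetilde\Psi\in\mathrm{Dom}(h)$, $\Psi\in\mathrm{Dom}(H)$. **Statement.** Suppose that the frame lies in a plane with unit normal $\vec n$ and that $\vec k_e=\vec n$ for every edge $e$. Then the Hamiltonian $H$ exists, is unique, and $H=H_1\oplus H_2$ with respect to the orthogonal decomposition $(v,w,u,\eta)\leftrightarrow\big((v,\eta),(w,u)\big)$ of $L^2(\Gamma)$, where: * $H_1$ acts as $(v_e,\eta_e)\mapsto(a_ev_e'''',\,-d_e\eta_e'')$ on the set of all $(v,\eta)\in\bigoplus_eH^4(0,\ell_e)\oplus\bigoplus_eH^2(0,\ell_e)$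 that satisfy at each vertex $\mathfrak v$ $$v_e=v_{e'},\qquad \eta_e\vec i_e-v_e'\vec j_e=\eta_{e'}\vec i_{e'}-v_{e'}'\vec j_{e'}\qquad\forall e,e'\sim\mathfrak v,$$ $$\sum_{e\sim\mathfrak v}s^e_{\mathfrak v}a_ev_e'''=0,\qquad \sum_{e\sim\mathfrak v}s^e_{\mathfrak v}\big(d_e\eta_e'\vec i_e-a_ev_e''\vec j_e\big)=\vec 0;$$ * $H_2$ acts as $(w_e,u_e)\mapsto(b_ew_e'''',\,-c_eu_e'')$ on the set of all $(w,u)\in\bigoplus_eH^4(0,\ell_e)\oplus\bigoplus_eH^2(0,\ell_e)$ that satisfy at each vertex $\mathfrak v$ $$u_e\vec i_e+w_e\vec j_e=u_{e'}\vec i_{e'}+w_{e'}\vec j_{e'},\qquad w_e'=w_{e'}'\qquad\forall e,e'\sim\mathfrak v,$$ $$\sum_{e\sim\mathfrak v}s^e_{\mathfrak v}\big(c_eu_e'\vec i_e-b_ew_e'''\vec j_e\big)=\vec 0,\qquad \sum_{e\sim\mathfrak v}s^e_{\mathfrak v}b_ew_e''=0.$$ Moreover, for all $\Psi=(v,w,u,\eta)$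 with $v_e,w_e\in H^4(0,\ell_e)$ and $u_e,\eta_e\in H^2(0,\ell_e)$, and at each vertex $\mathfrak v$, each of the following four conditions of a general frame is equivalent to the conjunction of the corresponding condition for $H_1$ and the corresponding condition for $H_2$ listed above (those in which the same quantities occur): (1) $u_e\vec i_e+w_e\vec j_e+v_e\vec k_e$ agree for all $e\sim\mathfrak v$ (equivalent to the conditions on $v_e$ and on $u_e\vec i_e+w_e\vec j_e$); (2) $\eta_e\vec i_e-v_e'\vec j_e+w_e'\vec k_e$ agree for all $e\sim\mathfrak v$; (3) $\sum_{e\sim\mathfrak v}s^e_{\mathfrak v}(c_eu_e'\vec i_e-b_ew_e'''\vec j_e-a_ev_e'''\vec k_e)=\vec0$; (4) $\sum_{e\sim\mathfrak v}s^e_{\mathfrak v}(d_e\eta_e'\vec i_e-a_ev_e''\vec j_e+b_ew_e''\vec k_e)=\vec0$. -/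

import Mathlib

open MeasureTheory Set Filter Topology
open scoped InnerProductSpace ContDiff

noncomputable section

namespace Beam

/-! ### Sobolev spaces on an interval `(0, ℓ)`, through weak derivatives -/

/-- The complex Hilbert space `L²(0, ℓ)`. -/
abbrev L2 (ℓ : ℝ) : Type := Lp ℂ 2 (volume.restrict (Ioo (0 : ℝ) ℓ))

/-- `φ` is a (real) test function on `(0, ℓ)`: smooth, with compact support inside `(0, ℓ)`. -/
def IsTest (ℓ : ℝ) (φ : ℝ → ℝ) : Prop :=
  ContDiff ℝ ∞ φ ∧ HasCompactSupport φ ∧ tsupport φ ⊆ Ioo (0 : ℝ) ℓ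

/-- `g ∈ L²(0, ℓ)` is the weak derivative of `f ∈ L²(0, ℓ)`. -/
def IsWeakDeriv {ℓ : ℝ} (f g : L2 ℓ) : Prop :=
  ∀ φ : ℝ → ℝ, IsTest ℓ φ →
    ∫ x in Ioo (0 : ℝ) ℓ, deriv φ x • f x = -∫ x in Ioo (0 : ℝ) ℓ, φ x • g x

/-- The Sobolev space `H^m(0, ℓ)`: the weak derivatives of orders `1, …, m` exist in `L²`. -/
def MemH {ℓ : ℝ} : ℕ → L2 ℓ → Prop
  | 0, _ => True
  | m + 1, f => ∃ g : L2 ℓ, IsWeakDeriv f g ∧ MemH m g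

open Classical in
/-- The weak derivative of `f` (`0` if there is none in `L²`). -/
def wderiv {ℓ : ℝ} (f : L2 ℓ) : L2 ℓ :=
  if h : ∃ g : L2 ℓ, IsWeakDeriv f g then h.choose else 0

/-- The weak derivative of order `n`; meaningful for `f ∈ H^n(0, ℓ)`. -/
def wderivs {ℓ : ℝ} : ℕ → L2 ℓ → L2 ℓ
  | 0, f => f
  | n + 1, f => wderivs n (wderiv f)

/-- `z` is the limit at `x₀` of the continuous representative of `f` on `(0, ℓ)`. -/
def HasEndValue {ℓ : ℝ} (f : L2 ℓ) (x₀ : ℝ) (z : ℂ) : Prop :=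
  ∃ g : ℝ → ℂ, ContinuousOn g (Ioo (0 : ℝ) ℓ) ∧
    (f : ℝ → ℂ) =ᵐ[volume.restrict (Ioo (0 : ℝ) ℓ)] g ∧ Tendsto g (𝓝[Ioo (0 : ℝ) ℓ] x₀) (𝓝 z)

open Classical in
/-- The value of `f` at an end `x₀ ∈ {0, ℓ}` of the interval (see `exists_hasEndValue`:
it exists for `f ∈ H¹(0, ℓ)`; the junk value is `0`). -/
def endValue {ℓ : ℝ} (f : L2 ℓ) (x₀ : ℝ) : ℂ :=
  if h : ∃ z : ℂ, HasEndValue f x₀ z then h.choose else 0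

section Facts

variable {ℓ : ℝ}

theorem integrable_L2 (f : L2 ℓ) : Integrable (f : ℝ → ℂ) (volume.restrict (Ioo (0 : ℝ) ℓ)) :=
  (Lp.memLp f).integrable (by norm_num)

theorem integrable_smul_L2 (f : L2 ℓ) {φ : ℝ → ℝ} (hφ : Continuous φ)
    (hc : HasCompactSupport φ) :
    Integrable (fun x => φ x • (f : ℝ → ℂ) x) (volume.restrict (Ioo (0 : ℝ) ℓ)) := by
  obtain ⟨C, hC⟩ := hc.exists_bound_of_continuous hφ
  exact (integrable_L2 f).bdd_smul C hφ.aestronglyMeasurable (Eventually.of_forall hC)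

theorem IsTest.continuous {φ : ℝ → ℝ} (h : IsTest ℓ φ) : Continuous φ := h.1.continuous

theorem IsTest.continuous_deriv {φ : ℝ → ℝ} (h : IsTest ℓ φ) : Continuous (deriv φ) :=
  h.1.continuous_deriv (by simp)

theorem IsWeakDeriv.add {f₁ f₂ g₁ g₂ : L2 ℓ} (h₁ : IsWeakDeriv f₁ g₁)
    (h₂ : IsWeakDeriv f₂ g₂) : IsWeakDeriv (f₁ + f₂) (g₁ + g₂) := by
  intro φ hφ
  have e1 : ∫ x in Ioo (0 : ℝ) ℓ, deriv φ x • (f₁ + f₂ : L2 ℓ) x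
      = ∫ x in Ioo (0 : ℝ) ℓ, (deriv φ x • f₁ x + deriv φ x • f₂ x) := by
    refine integral_congr_ae ?_
    filter_upwards [Lp.coeFn_add f₁ f₂] with x hx
    rw [hx, Pi.add_apply, smul_add]
  have e2 : ∫ x in Ioo (0 : ℝ) ℓ, φ x • (g₁ + g₂ : L2 ℓ) x
      = ∫ x in Ioo (0 : ℝ) ℓ, (φ x • g₁ x + φ x • g₂ x) := by
    refine integral_congr_ae ?_
    filter_upwards [Lp.coeFn_add g₁ g₂] with x hx
    rw [hx, Pi.add_apply, smul_add]
  rw [e1, e2, integral_add, integral_add, h₁ φ hφ, h₂ φ hφ, neg_add]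
  · exact integrable_smul_L2 _ hφ.continuous hφ.2.1
  · exact integrable_smul_L2 _ hφ.continuous hφ.2.1
  · exact integrable_smul_L2 _ hφ.continuous_deriv hφ.2.1.deriv
  · exact integrable_smul_L2 _ hφ.continuous_deriv hφ.2.1.deriv

theorem IsWeakDeriv.smul (c : ℂ) {f g : L2 ℓ} (h : IsWeakDeriv f g) :
    IsWeakDeriv (c • f) (c • g) := by
  intro φ hφ
  have e1 : ∫ x in Ioo (0 : ℝ) ℓ, deriv φ x • (c • f : L2 ℓ) x
      = ∫ x in Ioo (0 : ℝ) ℓ, c • (deriv φ x • f x) := by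
    refine integral_congr_ae ?_
    filter_upwards [Lp.coeFn_smul c f] with x hx
    rw [hx, Pi.smul_apply, smul_comm]
  have e2 : ∫ x in Ioo (0 : ℝ) ℓ, φ x • (c • g : L2 ℓ) x
      = ∫ x in Ioo (0 : ℝ) ℓ, c • (φ x • g x) := by
    refine integral_congr_ae ?_
    filter_upwards [Lp.coeFn_smul c g] with x hx
    rw [hx, Pi.smul_apply, smul_comm]
  rw [e1, e2, integral_smul, integral_smul, h φ hφ, smul_neg]

/-- A function in `L¹(0, ℓ)` that is orthogonal to all test functions vanishes. -/
theorem ae_zero_of_test {k : ℝ → ℂ} (hk : Integrable k (volume.restrict (Ioo (0 : ℝ) ℓ)))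
    (h : ∀ φ : ℝ → ℝ, IsTest ℓ φ → ∫ x in Ioo (0 : ℝ) ℓ, φ x • k x = 0) :
    k =ᵐ[volume.restrict (Ioo (0 : ℝ) ℓ)] 0 := by
  have := isOpen_Ioo.ae_eq_zero_of_integral_contDiff_smul_eq_zero (μ := volume)
    (U := Ioo (0 : ℝ) ℓ) (f := k) (IntegrableOn.locallyIntegrableOn hk) ?_
  · exact (ae_restrict_iff' measurableSet_Ioo).2 this
  · intro φ h1 h2 h3
    rw [← h φ ⟨h1, h2, h3⟩]
    symm
    refine setIntegral_eq_integral_of_forall_compl_eq_zero fun x hx => ?_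
    rw [image_eq_zero_of_notMem_tsupport (fun hx' => hx (h3 hx')), zero_smul]

theorem IsWeakDeriv.unique {f g₁ g₂ : L2 ℓ} (h₁ : IsWeakDeriv f g₁) (h₂ : IsWeakDeriv f g₂) :
    g₁ = g₂ := by
  have h := ae_zero_of_test ((integrable_L2 g₁).sub (integrable_L2 g₂)) (fun φ hφ => by
    have e : ∫ x in Ioo (0 : ℝ) ℓ, φ x • ((g₁ : ℝ → ℂ) - g₂) x
        = ∫ x in Ioo (0 : ℝ) ℓ, (φ x • g₁ x - φ x • g₂ x) := by
      simp only [Pi.sub_apply, smul_sub]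
    rw [e, integral_sub (integrable_smul_L2 _ hφ.continuous hφ.2.1)
      (integrable_smul_L2 _ hφ.continuous hφ.2.1), sub_eq_zero]
    exact neg_injective ((h₁ φ hφ).symm.trans (h₂ φ hφ)))
  refine Lp.ext ?_
  filter_upwards [h] with x hx
  exact sub_eq_zero.1 hx

theorem IsWeakDeriv.wderiv_eq {f g : L2 ℓ} (h : IsWeakDeriv f g) : wderiv f = g := by
  have hex : ∃ g : L2 ℓ, IsWeakDeriv f g := ⟨g, h⟩
  rw [wderiv, dif_pos hex]
  exact hex.choose_spec.unique h

theorem isWeakDeriv_zero : IsWeakDeriv (0 : L2 ℓ) 0 := by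
  have h : ∀ φ : ℝ → ℝ, ∫ x in Ioo (0 : ℝ) ℓ, φ x • (0 : L2 ℓ) x = 0 := fun φ => by
    rw [integral_eq_zero_of_ae]
    filter_upwards [Lp.coeFn_zero ℂ 2 (volume.restrict (Ioo (0 : ℝ) ℓ))] with x hx
    exact (congrArg (φ x • ·) hx).trans (smul_zero _)
  intro φ _
  rw [h, h, neg_zero]

theorem memH_zero : ∀ m : ℕ, MemH m (0 : L2 ℓ)
  | 0 => trivial
  | m + 1 => ⟨0, isWeakDeriv_zero, memH_zero m⟩

theorem MemH.add : ∀ {m : ℕ} {f g : L2 ℓ}, MemH m f → MemH m g → MemH m (f + g)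
  | 0, _, _, _, _ => trivial
  | _ + 1, _, _, ⟨_, h₁, k₁⟩, ⟨_, h₂, k₂⟩ => ⟨_, h₁.add h₂, k₁.add k₂⟩

theorem MemH.smul (c : ℂ) : ∀ {m : ℕ} {f : L2 ℓ}, MemH m f → MemH m (c • f)
  | 0, _, _ => trivial
  | _ + 1, _, ⟨_, h₁, k₁⟩ => ⟨_, h₁.smul c, k₁.smul c⟩

theorem MemH.wderivs : ∀ {n m : ℕ} {f : L2 ℓ}, MemH (n + m) f → MemH m (wderivs n f)
  | 0, m, f, h => by simpa [Beam.wderivs] using h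
  | n + 1, m, f, h => by
    rw [show n + 1 + m = (n + m) + 1 by ring] at h
    obtain ⟨g, hg, hm⟩ := h
    rw [Beam.wderivs, hg.wderiv_eq]
    exact hm.wderivs

theorem wderivs_zero : ∀ n : ℕ, wderivs n (0 : L2 ℓ) = 0
  | 0 => rfl
  | n + 1 => by rw [wderivs, isWeakDeriv_zero.wderiv_eq, wderivs_zero n]

theorem wderivs_add : ∀ {n : ℕ} {f g : L2 ℓ}, MemH n f → MemH n g →
    wderivs n (f + g) = wderivs n f + wderivs n g
  | 0, _, _, _, _ => rfl
  | n + 1, f, g, ⟨_, h₁, k₁⟩, ⟨_, h₂, k₂⟩ => by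
    simp only [wderivs, h₁.wderiv_eq, h₂.wderiv_eq, (h₁.add h₂).wderiv_eq]
    exact wderivs_add k₁ k₂

theorem wderivs_smul (c : ℂ) : ∀ {n : ℕ} {f : L2 ℓ}, MemH n f →
    wderivs n (c • f) = c • wderivs n f
  | 0, _, _ => rfl
  | n + 1, f, ⟨_, h₁, k₁⟩ => by
    simp only [wderivs, h₁.wderiv_eq, (h₁.smul c).wderiv_eq]
    exact wderivs_smul c k₁

theorem MemH.of_le {m n : ℕ} (hmn : m ≤ n) {f : L2 ℓ} (h : MemH n f) : MemH m f := by
  induction m generalizing n f with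
  | zero => trivial
  | succ m ih =>
    obtain ⟨n, rfl⟩ : ∃ k, n = k + 1 := ⟨n - 1, by omega⟩
    obtain ⟨g, hg, hn⟩ := h
    exact ⟨g, hg, ih (by omega) hn⟩

/-! Existence and linearity of the end values. -/

/-- The primitive of `g ∈ L²(0, ℓ)` has weak derivative `g`. -/
theorem integral_deriv_smul_primitive (g : L2 ℓ) {φ : ℝ → ℝ} (hφ : IsTest ℓ φ) :
    ∫ x in Ioo (0 : ℝ) ℓ, deriv φ x • (∫ y in Ioo (0 : ℝ) x, (g : ℝ → ℂ) y)
      = -∫ x in Ioo (0 : ℝ) ℓ, φ x • (g : ℝ → ℂ) x := by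
  set μ : Measure ℝ := volume.restrict (Ioo (0 : ℝ) ℓ) with hμ
  have hd : Integrable (deriv φ) μ :=
    ((hφ.continuous_deriv.integrable_of_hasCompactSupport hφ.2.1.deriv)).restrict
  have hS : MeasurableSet {p : ℝ × ℝ | p.2 < p.1} := measurableSet_lt measurable_snd measurable_fst
  have hI : Integrable (fun p : ℝ × ℝ =>
      {p : ℝ × ℝ | p.2 < p.1}.indicator (fun p => deriv φ p.1 • (g : ℝ → ℂ) p.2) p)
      (μ.prod μ) :=
    (hd.smul_prod (integrable_L2 g)).indicator hS
  have hF := integral_integral_swap (μ := μ) (ν := μ)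
    (f := fun x y => {p : ℝ × ℝ | p.2 < p.1}.indicator
      (fun p => deriv φ p.1 • (g : ℝ → ℂ) p.2) (x, y)) hI
  have hφ0 : ∀ x, x ∉ Ioo (0 : ℝ) ℓ → φ x = 0 := fun x hx =>
    image_eq_zero_of_notMem_tsupport fun h => hx (hφ.2.2 h)
  have hL : ∀ x ∈ Ioo (0 : ℝ) ℓ, ∫ y, {p : ℝ × ℝ | p.2 < p.1}.indicator
      (fun p => deriv φ p.1 • (g : ℝ → ℂ) p.2) (x, y) ∂μ
      = deriv φ x • (∫ y in Ioo (0 : ℝ) x, (g : ℝ → ℂ) y) := by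
    intro x hx
    have : (fun y => {p : ℝ × ℝ | p.2 < p.1}.indicator
        (fun p => deriv φ p.1 • (g : ℝ → ℂ) p.2) (x, y))
        = (Iio x).indicator (fun y => deriv φ x • (g : ℝ → ℂ) y) := by
      funext y; simp [indicator]
    rw [this, integral_indicator measurableSet_Iio, integral_smul, hμ,
      Measure.restrict_restrict measurableSet_Iio]
    congr 3
    ext y; simp only [mem_inter_iff, mem_Iio, mem_Ioo]
    exact ⟨fun h => ⟨h.2.1, h.1⟩, fun h => ⟨h.2, h.1, h.2.trans hx.2⟩⟩
  have hR : ∀ y ∈ Ioo (0 : ℝ) ℓ, ∫ x, {p : ℝ × ℝ | p.2 < p.1}.indicator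
      (fun p => deriv φ p.1 • (g : ℝ → ℂ) p.2) (x, y) ∂μ
      = -(φ y • (g : ℝ → ℂ) y) := by
    intro y hy
    have : (fun x => {p : ℝ × ℝ | p.2 < p.1}.indicator
        (fun p => deriv φ p.1 • (g : ℝ → ℂ) p.2) (x, y))
        = (Ioi y).indicator (fun x => deriv φ x • (g : ℝ → ℂ) y) := by
      funext x; simp [indicator]
    rw [this, integral_indicator measurableSet_Ioi, integral_smul_const, hμ,
      Measure.restrict_restrict measurableSet_Ioi]
    have hs : Ioi y ∩ Ioo (0 : ℝ) ℓ = Ioo y ℓ := by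
      ext x; simp only [mem_inter_iff, mem_Ioi, mem_Ioo]
      exact ⟨fun h => ⟨h.1, h.2.2⟩, fun h => ⟨h.1, hy.1.trans h.1, h.2⟩⟩
    rw [hs, ← integral_Ioc_eq_integral_Ioo, ← intervalIntegral.integral_of_le hy.2.le,
      intervalIntegral.integral_deriv_eq_sub
        (fun x _ => (hφ.1.differentiable (by simp)) x)
        (hφ.continuous_deriv.intervalIntegrable _ _), hφ0 ℓ (by simp), zero_sub, neg_smul]
  rw [setIntegral_congr_fun measurableSet_Ioo (fun x hx => (hL x hx).symm), hF,
    setIntegral_congr_fun measurableSet_Ioo (fun x hx => hR x hx), integral_neg]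

theorem continuous_primitive (g : L2 ℓ) :
    ContinuousOn (fun x => ∫ y in Ioo (0 : ℝ) x, (g : ℝ → ℂ) y) (Icc (0 : ℝ) ℓ) := by
  have h : IntegrableOn (g : ℝ → ℂ) (Icc (0 : ℝ) ℓ) volume :=
    (integrableOn_Icc_iff_integrableOn_Ioo).2 (integrable_L2 g)
  refine (intervalIntegral.continuousOn_primitive h).congr fun x _ => ?_
  exact (integral_Ioc_eq_integral_Ioo).symm

/-- The lemma of du Bois-Reymond. -/
theorem ae_const_of_test (hℓ : 0 < ℓ) {k : ℝ → ℂ}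
    (hk : Integrable k (volume.restrict (Ioo (0 : ℝ) ℓ)))
    (h : ∀ φ : ℝ → ℝ, IsTest ℓ φ → ∫ x in Ioo (0 : ℝ) ℓ, deriv φ x • k x = 0) :
    ∃ c : ℂ, k =ᵐ[volume.restrict (Ioo (0 : ℝ) ℓ)] fun _ => c := by
  obtain ⟨χ, hχ, hχ1⟩ : ∃ χ : ℝ → ℝ, IsTest ℓ χ ∧ ∫ x, χ x = 1 := by
    let b : ContDiffBump (ℓ / 2) := ⟨ℓ / 8, ℓ / 4, by linarith, by linarith⟩
    refine ⟨b.normed volume, ⟨b.contDiff_normed, b.hasCompactSupport_normed, ?_⟩,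
      b.integral_normed⟩
    rw [b.tsupport_normed_eq]
    intro x hx
    rw [Metric.mem_closedBall, Real.dist_eq, abs_le] at hx
    change -(ℓ / 4) ≤ x - ℓ / 2 ∧ x - ℓ / 2 ≤ ℓ / 4 at hx
    constructor <;> linarith [hx.1, hx.2]
  have hint : ∀ φ : ℝ → ℝ, IsTest ℓ φ →
      Integrable (fun x => φ x • k x) (volume.restrict (Ioo (0 : ℝ) ℓ)) := fun φ hφ => by
    obtain ⟨C, hC⟩ := hφ.2.1.exists_bound_of_continuous hφ.continuous
    exact hk.bdd_smul C hφ.continuous.aestronglyMeasurable (Eventually.of_forall hC)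
  set K : ℂ := ∫ x in Ioo (0 : ℝ) ℓ, χ x • k x with hK
  refine ⟨K, ?_⟩
  have key : ∀ ψ : ℝ → ℝ, IsTest ℓ ψ →
      ∫ x in Ioo (0 : ℝ) ℓ, ψ x • k x = (∫ x, ψ x) • K := by
    intro ψ hψ
    set c : ℝ := ∫ x, ψ x with hc
    set θ : ℝ → ℝ := fun x => ψ x - c * χ x with hθ
    have hθs : ContDiff ℝ ∞ θ := hψ.1.sub (contDiff_const.mul hχ.1)
    have hψi := hψ.continuous.integrable_of_hasCompactSupport hψ.2.1 (μ := volume)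
    have hχi := hχ.continuous.integrable_of_hasCompactSupport hχ.2.1 (μ := volume)
    have hθint : ∫ x, θ x = 0 := by
      rw [hθ, integral_sub hψi (hχi.const_mul c), integral_const_mul, hχ1, mul_one, sub_self]
    -- both supports lie in a compact subinterval
    obtain ⟨α, β, hα, hβ, hsub⟩ : ∃ α β : ℝ, 0 < α ∧ β < ℓ ∧
        tsupport ψ ∪ tsupport χ ⊆ Icc α β := by
      have hcomp : IsCompact (tsupport ψ ∪ tsupport χ) := hψ.2.1.isCompact.union hχ.2.1.isCompact
      have hne : (tsupport ψ ∪ tsupport χ).Nonempty := by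
        refine Nonempty.inr ?_
        by_contra hne
        rw [not_nonempty_iff_eq_empty, tsupport_eq_empty_iff] at hne
        simp [hne] at hχ1
      have hin : tsupport ψ ∪ tsupport χ ⊆ Ioo 0 ℓ := union_subset hψ.2.2 hχ.2.2
      exact ⟨sInf _, sSup _, (hin (hcomp.sInf_mem hne)).1, (hin (hcomp.sSup_mem hne)).2,
        fun x hx => ⟨csInf_le hcomp.bddBelow hx, le_csSup hcomp.bddAbove hx⟩⟩
    have hθ0 : ∀ x, x ∉ Icc α β → θ x = 0 := fun x hx => by
      have h1 : ψ x = 0 := image_eq_zero_of_notMem_tsupport fun h' => hx (hsub (Or.inl h'))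
      have h2 : χ x = 0 := image_eq_zero_of_notMem_tsupport fun h' => hx (hsub (Or.inr h'))
      simp [hθ, h1, h2]
    set φ : ℝ → ℝ := fun x => ∫ y in (0 : ℝ)..x, θ y with hφ
    have hφd : ∀ x, HasDerivAt φ (θ x) x := fun x =>
      intervalIntegral.integral_hasDerivAt_right (hθs.continuous.intervalIntegrable _ _)
        (hθs.continuous.stronglyMeasurableAtFilter _ _) hθs.continuous.continuousAt
    have hφ' : deriv φ = θ := funext fun x => (hφd x).deriv
    have hφs : ContDiff ℝ ∞ φ := by
      rw [contDiff_infty_iff_deriv, hφ']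
      exact ⟨fun x => (hφd x).differentiableAt, hθs⟩
    have hφ0 : ∀ x, x ∉ Icc α β → φ x = 0 := fun x hx => by
      rcases lt_or_ge x α with hxα | hxα
      · refine intervalIntegral.integral_zero_ae (Eventually.of_forall fun y hy => hθ0 y ?_)
        intro hy'
        rcases le_total 0 x with h0 | h0
        · rw [uIoc_of_le h0] at hy; linarith [hy.2, hy'.1]
        · rw [uIoc_of_ge h0] at hy; linarith [hy.2, hy'.1]
      · have hxβ : β < x := not_le.1 fun h' => hx ⟨hxα, h'⟩
        have hx0 : 0 ≤ x := by linarith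
        rw [hφ]
        simp only
        rw [intervalIntegral.integral_of_le hx0, ← hθint]
        refine setIntegral_eq_integral_of_forall_compl_eq_zero fun y hy => hθ0 y fun hy' => ?_
        exact hy ⟨by linarith [hy'.1], by linarith [hy'.2]⟩
    have hts : tsupport φ ⊆ Icc α β :=
      closure_minimal (fun x hx => by by_contra h'; exact hx (hφ0 x h')) isClosed_Icc
    have hφt : IsTest ℓ φ := ⟨hφs, HasCompactSupport.of_support_subset_isCompact isCompact_Icc
      ((subset_tsupport _).trans hts), fun x hx =>
        ⟨by linarith [(hts hx).1], by linarith [(hts hx).2]⟩⟩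
    have := h φ hφt
    rw [hφ'] at this
    have e : ∫ x in Ioo (0 : ℝ) ℓ, θ x • k x
        = ∫ x in Ioo (0 : ℝ) ℓ, (ψ x • k x - c • (χ x • k x)) := by
      refine integral_congr_ae (Eventually.of_forall fun x => ?_)
      simp only [hθ, sub_smul, mul_smul]
    have hs : Integrable (fun x => c • (χ x • k x)) (volume.restrict (Ioo (0 : ℝ) ℓ)) :=
      (hint χ hχ).smul c
    rw [e, integral_sub (hint ψ hψ) hs, integral_smul, sub_eq_zero] at this
    exact this
  have hfin : Integrable (fun _ : ℝ => K) (volume.restrict (Ioo (0 : ℝ) ℓ)) :=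
    integrable_const K
  have := ae_zero_of_test (hk.sub hfin) (fun ψ hψ => by
    have e : ∫ x in Ioo (0 : ℝ) ℓ, ψ x • (k - (fun _ : ℝ => K) : ℝ → ℂ) x
        = ∫ x in Ioo (0 : ℝ) ℓ, (ψ x • k x - ψ x • K) := by
      simp only [Pi.sub_apply, smul_sub]
    have hψi := hψ.continuous.integrable_of_hasCompactSupport hψ.2.1 (μ := volume)
    rw [e, integral_sub (hint ψ hψ) (hψi.restrict.smul_const K), integral_smul_const, key ψ hψ,
      setIntegral_eq_integral_of_forall_compl_eq_zero, sub_self]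
    intro x hx
    exact image_eq_zero_of_notMem_tsupport fun h' => hx (hψ.2.2 h'))
  filter_upwards [this] with x hx
  exact sub_eq_zero.1 hx

/-- A function in `H¹(0, ℓ)` has end values. -/
theorem exists_hasEndValue (hℓ : 0 < ℓ) {f : L2 ℓ} (hf : MemH 1 f) {x₀ : ℝ}
    (hx₀ : x₀ ∈ Icc 0 ℓ) : ∃ z : ℂ, HasEndValue f x₀ z := by
  obtain ⟨g, hg, -⟩ := hf
  set G : ℝ → ℂ := fun x => ∫ y in Ioo (0 : ℝ) x, (g : ℝ → ℂ) y with hG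
  have hGc : ContinuousOn G (Icc 0 ℓ) := continuous_primitive g
  have hGi : Integrable G (volume.restrict (Ioo (0 : ℝ) ℓ)) :=
    (hGc.integrableOn_Icc).mono_set Ioo_subset_Icc_self
  have hGs : ∀ φ : ℝ → ℝ, IsTest ℓ φ →
      Integrable (fun x => deriv φ x • G x) (volume.restrict (Ioo (0 : ℝ) ℓ)) := fun φ hφ => by
    obtain ⟨C, hC⟩ := hφ.2.1.deriv.exists_bound_of_continuous hφ.continuous_deriv
    exact hGi.bdd_smul C hφ.continuous_deriv.aestronglyMeasurable (Eventually.of_forall hC)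
  obtain ⟨c, hc⟩ := ae_const_of_test hℓ ((integrable_L2 f).sub hGi) (fun φ hφ => by
    have e : ∫ x in Ioo (0 : ℝ) ℓ, deriv φ x • ((f : ℝ → ℂ) - G) x
        = ∫ x in Ioo (0 : ℝ) ℓ, (deriv φ x • f x - deriv φ x • G x) := by
      simp only [Pi.sub_apply, smul_sub]
    rw [e, integral_sub (integrable_smul_L2 _ hφ.continuous_deriv hφ.2.1.deriv) (hGs φ hφ),
      hg φ hφ, integral_deriv_smul_primitive g hφ, sub_self])
  have hcG : ContinuousOn (fun x => c + G x) (Icc 0 ℓ) := continuousOn_const.add hGc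
  refine ⟨c + G x₀, fun x => c + G x, hcG.mono Ioo_subset_Icc_self, ?_,
    (hcG x₀ hx₀).mono Ioo_subset_Icc_self⟩
  filter_upwards [hc] with x hx
  rw [← hx, Pi.sub_apply, sub_add_cancel]

theorem HasEndValue.unique (hℓ : 0 < ℓ) {f : L2 ℓ} {x₀ : ℝ} (hx₀ : x₀ ∈ Icc 0 ℓ) {z w : ℂ}
    (hz : HasEndValue f x₀ z) (hw : HasEndValue f x₀ w) : z = w := by
  obtain ⟨g, hgc, hfg, hg⟩ := hz
  obtain ⟨k, hkc, hfk, hk⟩ := hw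
  have hgk : EqOn g k (Ioo 0 ℓ) :=
    Measure.eqOn_open_of_ae_eq (hfg.symm.trans hfk) isOpen_Ioo hgc hkc
  have hne : (𝓝[Ioo 0 ℓ] x₀).NeBot := by
    rw [← mem_closure_iff_nhdsWithin_neBot, closure_Ioo hℓ.ne]
    exact hx₀
  refine tendsto_nhds_unique hg (hk.congr' ?_)
  filter_upwards [self_mem_nhdsWithin] with x hx
  exact (hgk hx).symm

theorem HasEndValue.endValue_eq (hℓ : 0 < ℓ) {f : L2 ℓ} {x₀ : ℝ} (hx₀ : x₀ ∈ Icc 0 ℓ) {z : ℂ}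
    (hz : HasEndValue f x₀ z) : endValue f x₀ = z := by
  have hex : ∃ z : ℂ, HasEndValue f x₀ z := ⟨z, hz⟩
  rw [endValue, dif_pos hex]
  exact hex.choose_spec.unique hℓ hx₀ hz

theorem HasEndValue.add {f g : L2 ℓ} {x₀ : ℝ} {z w : ℂ} (hf : HasEndValue f x₀ z)
    (hg : HasEndValue g x₀ w) : HasEndValue (f + g) x₀ (z + w) := by
  obtain ⟨f', hc, he, ht⟩ := hf
  obtain ⟨g', hc', he', ht'⟩ := hg
  refine ⟨fun x => f' x + g' x, hc.add hc', ?_, ht.add ht'⟩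
  filter_upwards [Lp.coeFn_add f g, he, he'] with x h h1 h2
  rw [h, Pi.add_apply, h1, h2]

theorem HasEndValue.smul (c : ℂ) {f : L2 ℓ} {x₀ : ℝ} {z : ℂ} (hf : HasEndValue f x₀ z) :
    HasEndValue (c • f) x₀ (c * z) := by
  obtain ⟨f', hc, he, ht⟩ := hf
  refine ⟨fun x => c * f' x, continuousOn_const.mul hc, ?_, ht.const_mul c⟩
  filter_upwards [Lp.coeFn_smul c f, he] with x h h1
  rw [h, Pi.smul_apply, h1, smul_eq_mul]

theorem endValue_add (hℓ : 0 < ℓ) {x₀ : ℝ} (hx₀ : x₀ ∈ Icc 0 ℓ) {f g : L2 ℓ} (hf : MemH 1 f)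
    (hg : MemH 1 g) : endValue (f + g) x₀ = endValue f x₀ + endValue g x₀ := by
  obtain ⟨z, hz⟩ := exists_hasEndValue hℓ hf hx₀
  obtain ⟨w, hw⟩ := exists_hasEndValue hℓ hg hx₀
  rw [hz.endValue_eq hℓ hx₀, hw.endValue_eq hℓ hx₀, (hz.add hw).endValue_eq hℓ hx₀]

theorem endValue_smul (hℓ : 0 < ℓ) {x₀ : ℝ} (hx₀ : x₀ ∈ Icc 0 ℓ) (c : ℂ) {f : L2 ℓ}
    (hf : MemH 1 f) : endValue (c • f) x₀ = c * endValue f x₀ := by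
  obtain ⟨z, hz⟩ := exists_hasEndValue hℓ hf hx₀
  rw [hz.endValue_eq hℓ hx₀, (hz.smul c).endValue_eq hℓ hx₀]

end Facts

/-! ### Unbounded operators: unitary transport and orthogonal direct sums -/

section Operators

variable {X Y : Type*} [NormedAddCommGroup X] [InnerProductSpace ℂ X]
  [NormedAddCommGroup Y] [InnerProductSpace ℂ Y]

/-- The operator `U⁻¹ T U`, with domain `{x | U x ∈ dom T}`. -/
def transport (U : X ≃ₗᵢ[ℂ] Y) (T : Y →ₗ.[ℂ] Y) : X →ₗ.[ℂ] X where
  domain := T.domain.comap (U.toLinearEquiv : X →ₗ[ℂ] Y)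
  toFun :=
    { toFun := fun x => U.symm (T ⟨U x.1, x.2⟩)
      map_add' := fun x y => by
        rw [← map_add, ← LinearPMap.map_add]
        congr 2
        exact Subtype.ext (map_add U x.1 y.1)
      map_smul' := fun c x => by
        rw [RingHom.id_apply, ← map_smul, ← LinearPMap.map_smul]
        congr 2
        exact Subtype.ext (map_smul U c x.1) }

/-- The orthogonal direct sum `A ⊕ B : (x, y) ↦ (A x, B y)` on the Hilbert sum of `X` and `Y`,
with domain `dom A × dom B`. -/
def directSum (A : X →ₗ.[ℂ] X) (B : Y →ₗ.[ℂ] Y) :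
    WithLp 2 (X × Y) →ₗ.[ℂ] WithLp 2 (X × Y) where
  domain := (A.domain.prod B.domain).comap (WithLp.linearEquiv 2 ℂ (X × Y)).toLinearMap
  toFun :=
    { toFun := fun p => WithLp.toLp 2 (A ⟨p.1.fst, p.2.1⟩, B ⟨p.1.snd, p.2.2⟩)
      map_add' := fun p q => by
        rw [← WithLp.toLp_add, Prod.mk_add_mk, ← LinearPMap.map_add, ← LinearPMap.map_add]
        rfl
      map_smul' := fun c p => by
        rw [RingHom.id_apply, ← WithLp.toLp_smul, Prod.smul_mk, ← LinearPMap.map_smul,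
          ← LinearPMap.map_smul]
        rfl }

end Operators

/-! ### Beam frames -/

/-- A beam frame in `ℝ³` with vertices (joints) `V` and edges (beams) `E`: for each edge its
origin, terminus and length, an orthonormal right-handed basis `(i, j, k)` with `i` pointing from
origin to terminus, and the positive constant stiffnesses `a, b, c, d`. -/
structure Frame (V E : Type*) where
  /-- positions of the joints in the undeformed frame -/
  pos : V → EuclideanSpace ℝ (Fin 3)
  origin : E → V
  terminus : E → V
  len : E → ℝ
  i : E → EuclideanSpace ℝ (Fin 3)
  j : E → EuclideanSpace ℝ (Fin 3)
  k : E → EuclideanSpace ℝ (Fin 3)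
  a : E → ℝ
  b : E → ℝ
  c : E → ℝ
  d : E → ℝ
  len_pos : ∀ e, 0 < len e
  axis : ∀ e, pos (terminus e) - pos (origin e) = len e • i e
  orthonormal : ∀ e, Orthonormal ℝ ![i e, j e, k e]
  rightHanded : ∀ e, (i e).ofLp = crossProduct (j e).ofLp (k e).ofLp
  a_pos : ∀ e, 0 < a e
  b_pos : ∀ e, 0 < b e
  c_pos : ∀ e, 0 < c e
  d_pos : ∀ e, 0 < d e

/-- A vector of `ℝ³` seen in `ℂ³`. -/
def cvec (p : EuclideanSpace ℝ (Fin 3)) : Fin 3 → ℂ := fun m => (p m : ℂ)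

namespace Frame

variable {V E : Type*} [Fintype E] (F : Frame V E)

/-- The frame lies in a plane with unit normal `n`, and `k_e = n` for every edge. -/
def IsPlanar (n : EuclideanSpace ℝ (Fin 3)) : Prop :=
  ‖n‖ = 1 ∧ (∃ h : ℝ, ∀ 𝔳, ⟪n, F.pos 𝔳⟫_ℝ = h) ∧ ∀ e, F.k e = n

/-- One scalar field on the frame: `⊕_e L²(e)`. -/
abbrev Field : Type _ := PiLp 2 (fun e : E => L2 (F.len e))

/-- The space `L²(Γ)` of states `Ψ = (v, w, u, η) = (Ψ 0, Ψ 1, Ψ 2, Ψ 3)`. -/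
abbrev State : Type _ := PiLp 2 (fun _ : Fin 4 => F.Field)

/-- The space of pairs of fields: `(v, η)` for `H₁`, `(w, u)` for `H₂`. -/
abbrev Pair : Type _ := PiLp 2 (fun _ : Fin 2 => F.Field)

/-- `e ∼ 𝔳`. -/
def Incident (e : E) (𝔳 : V) : Prop := F.origin e = 𝔳 ∨ F.terminus e = 𝔳

open Classical in
/-- The signed incidence indicator `s_𝔳^e`. -/
def sign (𝔳 : V) (e : E) : ℂ :=
  if F.origin e = 𝔳 then 1 else if F.terminus e = 𝔳 then -1 else 0

open Classical in
/-- The arc-length coordinate on `e` of its end `𝔳` (used for `e ∼ 𝔳`). -/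
def coord (𝔳 : V) (e : E) : ℝ := if F.origin e = 𝔳 then 0 else F.len e

/-- The value at `𝔳` of the `n`-th derivative of `f_e` (in the direction `i_e`). -/
def val (𝔳 : V) (n : ℕ) (f : F.Field) (e : E) : ℂ := endValue (wderivs n (f e)) (F.coord 𝔳 e)

/-- All edge functions `f_e` are in `H^m(e)`. -/
def InH (m : ℕ) (f : F.Field) : Prop := ∀ e, MemH m (f e)

/-- `x e` is the same for all `e ∼ 𝔳`. -/
def Agree {A : Type*} (𝔳 : V) (x : E → A) : Prop :=
  ∀ e e', F.Incident e 𝔳 → F.Incident e' 𝔳 → x e = x e'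

open Classical in
/-- `∑_{e ∼ 𝔳} s_𝔳^e x_e = 0`. -/
def Balanced {A : Type*} [AddCommGroup A] [Module ℂ A] (𝔳 : V) (x : E → A) : Prop :=
  ∑ e with F.Incident e 𝔳, F.sign 𝔳 e • x e = 0

/-! The rigid joint conditions of a general frame. -/

/-- Continuity of displacement: `u_e i_e + w_e j_e + v_e k_e` agree for all `e ∼ 𝔳`. -/
def DisplacementCont (Ψ : F.State) (𝔳 : V) : Prop :=
  F.Agree 𝔳 fun e => F.val 𝔳 0 (Ψ 2) e • cvec (F.i e) + F.val 𝔳 0 (Ψ 1) e • cvec (F.j e)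
    + F.val 𝔳 0 (Ψ 0) e • cvec (F.k e)

/-- Continuity of rotation: `η_e i_e - v_e' j_e + w_e' k_e` agree for all `e ∼ 𝔳`. -/
def RotationCont (Ψ : F.State) (𝔳 : V) : Prop :=
  F.Agree 𝔳 fun e => F.val 𝔳 0 (Ψ 3) e • cvec (F.i e) - F.val 𝔳 1 (Ψ 0) e • cvec (F.j e)
    + F.val 𝔳 1 (Ψ 1) e • cvec (F.k e)

/-- Balance of forces:
`∑_{e ∼ 𝔳} s_𝔳^e (c_e u_e' i_e - b_e w_e''' j_e - a_e v_e''' k_e) = 0`. -/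
def ForceBalance (Ψ : F.State) (𝔳 : V) : Prop :=
  F.Balanced 𝔳 fun e => (F.c e * F.val 𝔳 1 (Ψ 2) e) • cvec (F.i e)
    - (F.b e * F.val 𝔳 3 (Ψ 1) e) • cvec (F.j e) - (F.a e * F.val 𝔳 3 (Ψ 0) e) • cvec (F.k e)

/-- Balance of moments:
`∑_{e ∼ 𝔳} s_𝔳^e (d_e η_e' i_e - a_e v_e'' j_e + b_e w_e'' k_e) = 0`. -/
def MomentBalance (Ψ : F.State) (𝔳 : V) : Prop :=
  F.Balanced 𝔳 fun e => (F.d e * F.val 𝔳 1 (Ψ 3) e) • cvec (F.i e)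
    - (F.a e * F.val 𝔳 2 (Ψ 0) e) • cvec (F.j e) + (F.b e * F.val 𝔳 2 (Ψ 1) e) • cvec (F.k e)

/-! The energy form and its Hamiltonian. -/

/-- The domain of the energy form: `v, w ∈ H²`, `u, η ∈ H¹` on every edge, with free rigid
joints. -/
def InFormDomain (Ψ : F.State) : Prop :=
  (F.InH 2 (Ψ 0) ∧ F.InH 2 (Ψ 1) ∧ F.InH 1 (Ψ 2) ∧ F.InH 1 (Ψ 3)) ∧
    ∀ 𝔳, F.DisplacementCont Ψ 𝔳 ∧ F.RotationCont Ψ 𝔳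

/-- The sesquilinear strain energy form `h[Φ, Ψ]`: the sum over the edges of the integrals of
`a conj(v_Φ'') v_Ψ'' + b conj(w_Φ'') w_Ψ'' + c conj(u_Φ') u_Ψ' + d conj(η_Φ') η_Ψ'`. -/
def energy (Φ Ψ : F.State) : ℂ :=
  ∑ e, ((F.a e : ℂ) * ⟪wderivs 2 (Φ 0 e), wderivs 2 (Ψ 0 e)⟫_ℂ
    + (F.b e : ℂ) * ⟪wderivs 2 (Φ 1 e), wderivs 2 (Ψ 1 e)⟫_ℂ
    + (F.c e : ℂ) * ⟪wderivs 1 (Φ 2 e), wderivs 1 (Ψ 2 e)⟫_ℂ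
    + (F.d e : ℂ) * ⟪wderivs 1 (Φ 3 e), wderivs 1 (Ψ 3 e)⟫_ℂ)

/-- `H` is the Hamiltonian of the frame: a (densely defined) self-adjoint operator on `L²(Γ)` with
`dom H ⊆ dom h` and `h[Φ, Ψ] = ⟪Φ, H Ψ⟫` for all `Φ ∈ dom h`, `Ψ ∈ dom H`. -/
def IsHamiltonian (H : F.State →ₗ.[ℂ] F.State) : Prop :=
  IsSelfAdjoint H ∧ (∀ Ψ : H.domain, F.InFormDomain Ψ) ∧
    ∀ Φ : F.State, F.InFormDomain Φ → ∀ Ψ : H.domain, F.energy Φ Ψ = ⟪Φ, H Ψ⟫_ℂ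

/-! Linearity of the vertex values. -/

section Linear

set_option linter.unusedSectionVars false

variable {F}

theorem coord_mem (𝔳 : V) (e : E) : F.coord 𝔳 e ∈ Icc 0 (F.len e) := by
  unfold coord
  split_ifs
  · exact ⟨le_rfl, (F.len_pos e).le⟩
  · exact ⟨(F.len_pos e).le, le_rfl⟩

theorem InH.add {m : ℕ} {f g : F.Field} (hf : F.InH m f) (hg : F.InH m g) : F.InH m (f + g) :=
  fun e => (hf e).add (hg e)

theorem InH.smul {m : ℕ} (z : ℂ) {f : F.Field} (hf : F.InH m f) : F.InH m (z • f) :=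
  fun e => (hf e).smul z

theorem inH_zero {m : ℕ} : F.InH m 0 := fun _ => memH_zero m

theorem val_add {m n : ℕ} (hn : n + 1 ≤ m) {f g : F.Field} (hf : F.InH m f) (hg : F.InH m g)
    (𝔳 : V) : F.val 𝔳 n (f + g) = F.val 𝔳 n f + F.val 𝔳 n g := by
  funext e
  have h1 := (hf e).of_le hn
  have h2 := (hg e).of_le hn
  simp only [val, Pi.add_apply, PiLp.add_apply]
  rw [wderivs_add (h1.of_le (by omega)) (h2.of_le (by omega)),
    endValue_add (F.len_pos e) (coord_mem 𝔳 e) h1.wderivs h2.wderivs]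

theorem val_smul {m n : ℕ} (hn : n + 1 ≤ m) (z : ℂ) {f : F.Field} (hf : F.InH m f) (𝔳 : V) :
    F.val 𝔳 n (z • f) = z • F.val 𝔳 n f := by
  funext e
  have h1 := (hf e).of_le hn
  simp only [val, Pi.smul_apply, PiLp.smul_apply, smul_eq_mul]
  rw [wderivs_smul z (h1.of_le (by omega)),
    endValue_smul (F.len_pos e) (coord_mem 𝔳 e) z h1.wderivs]

theorem val_zero (𝔳 : V) (n : ℕ) : F.val 𝔳 n 0 = 0 := by
  have := val_smul (le_refl (n + 1)) (0 : ℂ) (inH_zero (F := F)) 𝔳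
  rwa [zero_smul, zero_smul] at this

theorem Agree.add {A : Type*} [Add A] {𝔳 : V} {x y : E → A} (hx : F.Agree 𝔳 x)
    (hy : F.Agree 𝔳 y) : F.Agree 𝔳 (x + y) := fun e e' h h' => by
  rw [Pi.add_apply, Pi.add_apply, hx e e' h h', hy e e' h h']

theorem Agree.smul {A : Type*} [SMul ℂ A] {𝔳 : V} (z : ℂ) {x : E → A} (hx : F.Agree 𝔳 x) :
    F.Agree 𝔳 (z • x) := fun e e' h h' => by
  rw [Pi.smul_apply, Pi.smul_apply, hx e e' h h']

theorem Balanced.add {A : Type*} [AddCommGroup A] [Module ℂ A] {𝔳 : V} {x y : E → A}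
    (hx : F.Balanced 𝔳 x) (hy : F.Balanced 𝔳 y) : F.Balanced 𝔳 (x + y) := by
  unfold Balanced at *
  simp only [Pi.add_apply, smul_add, Finset.sum_add_distrib, hx, hy, add_zero]

theorem Balanced.smul {A : Type*} [AddCommGroup A] [Module ℂ A] {𝔳 : V} (z : ℂ) {x : E → A}
    (hx : F.Balanced 𝔳 x) : F.Balanced 𝔳 (z • x) := by
  unfold Balanced at *
  simp only [Pi.smul_apply, smul_comm _ z]
  rw [← Finset.smul_sum, hx, smul_zero]

end Linear

/-! The operator `H₁` on pairs `Φ = (v, η) = (Φ 0, Φ 1)`. -/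

/-- `v_e = v_{e'}` for all `e, e' ∼ 𝔳`. -/
def DisplacementCont₁ (v : F.Field) (𝔳 : V) : Prop := F.Agree 𝔳 (F.val 𝔳 0 v)

/-- `η_e i_e - v_e' j_e` agree for all `e ∼ 𝔳`. -/
def RotationCont₁ (v η : F.Field) (𝔳 : V) : Prop :=
  F.Agree 𝔳 fun e => F.val 𝔳 0 η e • cvec (F.i e) - F.val 𝔳 1 v e • cvec (F.j e)

/-- `∑_{e ∼ 𝔳} s_𝔳^e a_e v_e''' = 0`. -/
def ForceBalance₁ (v : F.Field) (𝔳 : V) : Prop :=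
  F.Balanced 𝔳 fun e => F.a e * F.val 𝔳 3 v e

/-- `∑_{e ∼ 𝔳} s_𝔳^e (d_e η_e' i_e - a_e v_e'' j_e) = 0`. -/
def MomentBalance₁ (v η : F.Field) (𝔳 : V) : Prop :=
  F.Balanced 𝔳 fun e => (F.d e * F.val 𝔳 1 η e) • cvec (F.i e)
    - (F.a e * F.val 𝔳 2 v e) • cvec (F.j e)

/-- The domain of `H₁`. -/
def InDomain₁ (Φ : F.Pair) : Prop :=
  (F.InH 4 (Φ 0) ∧ F.InH 2 (Φ 1)) ∧
    ∀ 𝔳, (F.DisplacementCont₁ (Φ 0) 𝔳 ∧ F.RotationCont₁ (Φ 0) (Φ 1) 𝔳) ∧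
      F.ForceBalance₁ (Φ 0) 𝔳 ∧ F.MomentBalance₁ (Φ 0) (Φ 1) 𝔳

/-- `(v, η) ↦ (a v'''', -d η'')`. -/
def action₁ (Φ : F.Pair) : F.Pair :=
  WithLp.toLp 2 ![WithLp.toLp 2 fun e => (F.a e : ℂ) • wderivs 4 (Φ 0 e),
    WithLp.toLp 2 fun e => -(F.d e : ℂ) • wderivs 2 (Φ 1 e)]

/-! The operator `H₂` on pairs `Φ = (w, u) = (Φ 0, Φ 1)`. -/

/-- `u_e i_e + w_e j_e` agree for all `e ∼ 𝔳`. -/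
def DisplacementCont₂ (w u : F.Field) (𝔳 : V) : Prop :=
  F.Agree 𝔳 fun e => F.val 𝔳 0 u e • cvec (F.i e) + F.val 𝔳 0 w e • cvec (F.j e)

/-- `w_e' = w_{e'}'` for all `e, e' ∼ 𝔳`. -/
def RotationCont₂ (w : F.Field) (𝔳 : V) : Prop := F.Agree 𝔳 (F.val 𝔳 1 w)

/-- `∑_{e ∼ 𝔳} s_𝔳^e (c_e u_e' i_e - b_e w_e''' j_e) = 0`. -/
def ForceBalance₂ (w u : F.Field) (𝔳 : V) : Prop :=
  F.Balanced 𝔳 fun e => (F.c e * F.val 𝔳 1 u e) • cvec (F.i e)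
    - (F.b e * F.val 𝔳 3 w e) • cvec (F.j e)

/-- `∑_{e ∼ 𝔳} s_𝔳^e b_e w_e'' = 0`. -/
def MomentBalance₂ (w : F.Field) (𝔳 : V) : Prop :=
  F.Balanced 𝔳 fun e => F.b e * F.val 𝔳 2 w e

/-- The domain of `H₂`. -/
def InDomain₂ (Φ : F.Pair) : Prop :=
  (F.InH 4 (Φ 0) ∧ F.InH 2 (Φ 1)) ∧
    ∀ 𝔳, (F.DisplacementCont₂ (Φ 0) (Φ 1) 𝔳 ∧ F.RotationCont₂ (Φ 0) 𝔳) ∧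
      F.ForceBalance₂ (Φ 0) (Φ 1) 𝔳 ∧ F.MomentBalance₂ (Φ 0) 𝔳

/-- `(w, u) ↦ (b w'''', -c u'')`. -/
def action₂ (Φ : F.Pair) : F.Pair :=
  WithLp.toLp 2 ![WithLp.toLp 2 fun e => (F.b e : ℂ) • wderivs 4 (Φ 0 e),
    WithLp.toLp 2 fun e => -(F.c e : ℂ) • wderivs 2 (Φ 1 e)]

section Closure

variable {F}

theorem InDomain₁.add {Φ Χ : F.Pair} (h : F.InDomain₁ Φ) (h' : F.InDomain₁ Χ) :
    F.InDomain₁ (Φ + Χ) := by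
  obtain ⟨⟨h0, h1⟩, hc⟩ := h
  obtain ⟨⟨k0, k1⟩, kc⟩ := h'
  refine ⟨⟨h0.add k0, h1.add k1⟩, fun 𝔳 => ?_⟩
  obtain ⟨⟨c1, c2⟩, c3, c4⟩ := hc 𝔳
  obtain ⟨⟨d1, d2⟩, d3, d4⟩ := kc 𝔳
  have e0 := fun n (hn : n + 1 ≤ 4) => val_add hn h0 k0 𝔳
  have e1 := fun n (hn : n + 1 ≤ 2) => val_add hn h1 k1 𝔳
  refine ⟨⟨?_, ?_⟩, ?_, ?_⟩
  · rw [DisplacementCont₁, PiLp.add_apply, e0 0 (by norm_num)]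
    exact c1.add d1
  · rw [RotationCont₁, PiLp.add_apply, PiLp.add_apply, e0 1 (by norm_num), e1 0 (by norm_num)]
    convert c2.add d2 using 1
    funext e
    simp only [Pi.add_apply]
    module
  · rw [ForceBalance₁, PiLp.add_apply, e0 3 (by norm_num)]
    convert c3.add d3 using 1
    funext e
    simp only [Pi.add_apply]
    ring
  · rw [MomentBalance₁, PiLp.add_apply, PiLp.add_apply, e0 2 (by norm_num), e1 1 (by norm_num)]
    convert c4.add d4 using 1
    funext e
    simp only [Pi.add_apply]
    module

theorem InDomain₁.smul (z : ℂ) {Φ : F.Pair} (h : F.InDomain₁ Φ) : F.InDomain₁ (z • Φ) := by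
  obtain ⟨⟨h0, h1⟩, hc⟩ := h
  refine ⟨⟨h0.smul z, h1.smul z⟩, fun 𝔳 => ?_⟩
  obtain ⟨⟨c1, c2⟩, c3, c4⟩ := hc 𝔳
  have e0 := fun n (hn : n + 1 ≤ 4) => val_smul hn z h0 𝔳
  have e1 := fun n (hn : n + 1 ≤ 2) => val_smul hn z h1 𝔳
  refine ⟨⟨?_, ?_⟩, ?_, ?_⟩
  · rw [DisplacementCont₁, PiLp.smul_apply, e0 0 (by norm_num)]
    exact c1.smul z
  · rw [RotationCont₁, PiLp.smul_apply, PiLp.smul_apply, e0 1 (by norm_num), e1 0 (by norm_num)]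
    convert c2.smul z using 1
    funext e
    simp only [Pi.smul_apply, smul_eq_mul]
    module
  · rw [ForceBalance₁, PiLp.smul_apply, e0 3 (by norm_num)]
    convert c3.smul z using 1
    funext e
    simp only [Pi.smul_apply, smul_eq_mul]
    ring
  · rw [MomentBalance₁, PiLp.smul_apply, PiLp.smul_apply, e0 2 (by norm_num), e1 1 (by norm_num)]
    convert c4.smul z using 1
    funext e
    simp only [Pi.smul_apply, smul_eq_mul]
    module

theorem InDomain₂.add {Φ Χ : F.Pair} (h : F.InDomain₂ Φ) (h' : F.InDomain₂ Χ) :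
    F.InDomain₂ (Φ + Χ) := by
  obtain ⟨⟨h0, h1⟩, hc⟩ := h
  obtain ⟨⟨k0, k1⟩, kc⟩ := h'
  refine ⟨⟨h0.add k0, h1.add k1⟩, fun 𝔳 => ?_⟩
  obtain ⟨⟨c1, c2⟩, c3, c4⟩ := hc 𝔳
  obtain ⟨⟨d1, d2⟩, d3, d4⟩ := kc 𝔳
  have e0 := fun n (hn : n + 1 ≤ 4) => val_add hn h0 k0 𝔳
  have e1 := fun n (hn : n + 1 ≤ 2) => val_add hn h1 k1 𝔳
  refine ⟨⟨?_, ?_⟩, ?_, ?_⟩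
  · rw [DisplacementCont₂, PiLp.add_apply, PiLp.add_apply, e0 0 (by norm_num), e1 0 (by norm_num)]
    convert c1.add d1 using 1
    funext e
    simp only [Pi.add_apply]
    module
  · rw [RotationCont₂, PiLp.add_apply, e0 1 (by norm_num)]
    exact c2.add d2
  · rw [ForceBalance₂, PiLp.add_apply, PiLp.add_apply, e0 3 (by norm_num), e1 1 (by norm_num)]
    convert c3.add d3 using 1
    funext e
    simp only [Pi.add_apply]
    module
  · rw [MomentBalance₂, PiLp.add_apply, e0 2 (by norm_num)]
    convert c4.add d4 using 1
    funext e
    simp only [Pi.add_apply]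
    ring

theorem InDomain₂.smul (z : ℂ) {Φ : F.Pair} (h : F.InDomain₂ Φ) : F.InDomain₂ (z • Φ) := by
  obtain ⟨⟨h0, h1⟩, hc⟩ := h
  refine ⟨⟨h0.smul z, h1.smul z⟩, fun 𝔳 => ?_⟩
  obtain ⟨⟨c1, c2⟩, c3, c4⟩ := hc 𝔳
  have e0 := fun n (hn : n + 1 ≤ 4) => val_smul hn z h0 𝔳
  have e1 := fun n (hn : n + 1 ≤ 2) => val_smul hn z h1 𝔳
  refine ⟨⟨?_, ?_⟩, ?_, ?_⟩
  · rw [DisplacementCont₂, PiLp.smul_apply, PiLp.smul_apply, e0 0 (by norm_num),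
      e1 0 (by norm_num)]
    convert c1.smul z using 1
    funext e
    simp only [Pi.smul_apply, smul_eq_mul]
    module
  · rw [RotationCont₂, PiLp.smul_apply, e0 1 (by norm_num)]
    exact c2.smul z
  · rw [ForceBalance₂, PiLp.smul_apply, PiLp.smul_apply, e0 3 (by norm_num), e1 1 (by norm_num)]
    convert c3.smul z using 1
    funext e
    simp only [Pi.smul_apply, smul_eq_mul]
    module
  · rw [MomentBalance₂, PiLp.smul_apply, e0 2 (by norm_num)]
    convert c4.smul z using 1
    funext e
    simp only [Pi.smul_apply, smul_eq_mul]
    ring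

theorem inDomain₁_zero : F.InDomain₁ 0 :=
  ⟨⟨inH_zero, inH_zero⟩, fun 𝔳 => by
    simp [DisplacementCont₁, RotationCont₁, ForceBalance₁, MomentBalance₁, Agree, Balanced,
      val_zero]⟩

theorem inDomain₂_zero : F.InDomain₂ 0 :=
  ⟨⟨inH_zero, inH_zero⟩, fun 𝔳 => by
    simp [DisplacementCont₂, RotationCont₂, ForceBalance₂, MomentBalance₂, Agree, Balanced,
      val_zero]⟩

theorem action₁_add {Φ Χ : F.Pair} (h : F.InDomain₁ Φ) (h' : F.InDomain₁ Χ) :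
    F.action₁ (Φ + Χ) = F.action₁ Φ + F.action₁ Χ := by
  ext m : 1
  refine WithLp.ofLp_injective 2 (funext fun e => ?_)
  fin_cases m
  · exact (congrArg ((F.a e : ℂ) • ·) (wderivs_add (h.1.1 e) (h'.1.1 e))).trans (smul_add _ _ _)
  · exact (congrArg (-(F.d e : ℂ) • ·) (wderivs_add (h.1.2 e) (h'.1.2 e))).trans
      (smul_add _ _ _)

theorem action₁_smul (z : ℂ) {Φ : F.Pair} (h : F.InDomain₁ Φ) :
    F.action₁ (z • Φ) = z • F.action₁ Φ := by
  ext m : 1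
  refine WithLp.ofLp_injective 2 (funext fun e => ?_)
  fin_cases m
  · exact (congrArg ((F.a e : ℂ) • ·) (wderivs_smul z (h.1.1 e))).trans (smul_comm _ _ _)
  · exact (congrArg (-(F.d e : ℂ) • ·) (wderivs_smul z (h.1.2 e))).trans (smul_comm _ _ _)

theorem action₂_add {Φ Χ : F.Pair} (h : F.InDomain₂ Φ) (h' : F.InDomain₂ Χ) :
    F.action₂ (Φ + Χ) = F.action₂ Φ + F.action₂ Χ := by
  ext m : 1
  refine WithLp.ofLp_injective 2 (funext fun e => ?_)
  fin_cases m
  · exact (congrArg ((F.b e : ℂ) • ·) (wderivs_add (h.1.1 e) (h'.1.1 e))).trans (smul_add _ _ _)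
  · exact (congrArg (-(F.c e : ℂ) • ·) (wderivs_add (h.1.2 e) (h'.1.2 e))).trans
      (smul_add _ _ _)

theorem action₂_smul (z : ℂ) {Φ : F.Pair} (h : F.InDomain₂ Φ) :
    F.action₂ (z • Φ) = z • F.action₂ Φ := by
  ext m : 1
  refine WithLp.ofLp_injective 2 (funext fun e => ?_)
  fin_cases m
  · exact (congrArg ((F.b e : ℂ) • ·) (wderivs_smul z (h.1.1 e))).trans (smul_comm _ _ _)
  · exact (congrArg (-(F.c e : ℂ) • ·) (wderivs_smul z (h.1.2 e))).trans (smul_comm _ _ _)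

end Closure

/-- The operator `H₁`, coupling out-of-plane and angular displacement. -/
def H₁ : F.Pair →ₗ.[ℂ] F.Pair where
  domain :=
    { carrier := {Φ | F.InDomain₁ Φ}
      add_mem' := InDomain₁.add
      zero_mem' := inDomain₁_zero
      smul_mem' := fun z _ h => InDomain₁.smul z h }
  toFun :=
    { toFun := fun Φ => F.action₁ Φ
      map_add' := fun Φ Χ => action₁_add Φ.2 Χ.2
      map_smul' := fun z Φ => action₁_smul z Φ.2 }

/-- The operator `H₂`, coupling in-plane and axial displacement. -/
def H₂ : F.Pair →ₗ.[ℂ] F.Pair where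
  domain :=
    { carrier := {Φ | F.InDomain₂ Φ}
      add_mem' := InDomain₂.add
      zero_mem' := inDomain₂_zero
      smul_mem' := fun z _ h => InDomain₂.smul z h }
  toFun :=
    { toFun := fun Φ => F.action₂ Φ
      map_add' := fun Φ Χ => action₂_add Φ.2 Χ.2
      map_smul' := fun z Φ => action₂_smul z Φ.2 }

/-- The unitary rearrangement `(v, w, u, η) ↦ ((v, η), (w, u))`. -/
def split : F.State ≃ₗᵢ[ℂ] WithLp 2 (F.Pair × F.Pair) where
  toFun Ψ := WithLp.toLp 2 (WithLp.toLp 2 ![Ψ 0, Ψ 3], WithLp.toLp 2 ![Ψ 1, Ψ 2])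
  invFun p := WithLp.toLp 2 ![p.fst 0, p.snd 0, p.snd 1, p.fst 1]
  map_add' Φ Ψ := by
    refine WithLp.ofLp_injective 2 (Prod.ext ?_ ?_) <;> ext m : 1 <;> fin_cases m <;> rfl
  map_smul' z Ψ := by
    refine WithLp.ofLp_injective 2 (Prod.ext ?_ ?_) <;> ext m : 1 <;> fin_cases m <;> rfl
  left_inv Ψ := by ext m : 1; fin_cases m <;> rfl
  right_inv p := by
    refine WithLp.ofLp_injective 2 (Prod.ext ?_ ?_) <;> ext m : 1 <;> fin_cases m <;> rfl
  norm_map' Ψ := by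
    rw [← sq_eq_sq₀ (norm_nonneg _) (norm_nonneg _), WithLp.prod_norm_sq_eq_of_L2,
      PiLp.norm_sq_eq_of_L2]
    simp [PiLp.norm_sq_eq_of_L2, Fin.sum_univ_four]
    ring

end Frame

end Beam
end

/-!
The energy form of a frame is `h[Φ, Ψ] = ⟪A Φ, A Ψ⟫` for the strain operator
`A = (√a v'', √b w'', √c u', √d η')` with domain `Dom h` (`Frame.strain`). If `A` is closed, the
only self-adjoint operator that represents the form is the operator `T` with graph
`{(Ψ, Θ) | Ψ ∈ Dom h, ∀ Φ ∈ Dom h, h[Φ, Ψ] = ⟪Φ, Θ⟫}` (`isSelfAdjoint_and_form_iff_eq`): it is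
symmetric, `T + 1` is onto because `(Θ, 0)` can be projected orthogonally to the graph of `A`, and
a self-adjoint operator has no proper self-adjoint extension.

`A` is closed (`Frame.strain_isClosed`) because the weak derivatives are closed operators, and the
end values are continuous in their graph norms: Green's identity with a cubic Hermite interpolant
writes an end value as a sum of inner products (`exists_inner_eq_endValue_two`).

It remains to identify `T` (`Frame.inFormDomain_and_energy_eq_inner_iff`). Testing with functions
supported inside one edge shows that `a v''` and `b w''` have second, and `c u'` and `d η'` first,
distributional derivatives in `L²`; by the lemma of du Bois-Reymond, to second order in
`exists_isWeakDeriv_isWeakDeriv`, this gives the `H⁴` and `H²` regularity and the action. Green's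
identity then reduces `h[Φ, Ψ] - ⟪Φ, T Ψ⟫` to a sum over the joints of
`displacement · net force + rotation · net moment`. Since a single joint can be displaced and
rotated at will with the other joints clamped (`Frame.exists_inFormDomain_disp_rot`), this sum
vanishes for all `Φ ∈ Dom h` if and only if forces and moments balance at every joint.

Finally, if all `k_e` equal the normal `n`, each of the four vertex conditions splits into its
component along `n` and its components in the plane (`Frame.IsPlanar.agree_iff`,
`Frame.IsPlanar.balanced_iff`), which turns the domain of `T` into that of `H₁ ⊕ H₂`.
-/

noncomputable section

namespace Beam

/-! ### The self-adjoint operator of a closed form -/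

section FormOperator

variable {X Y : Type*} [NormedAddCommGroup X] [InnerProductSpace ℂ X] [CompleteSpace X]
  [NormedAddCommGroup Y] [InnerProductSpace ℂ Y] [CompleteSpace Y]

/-- If `A` has a closed graph then `A*A + 1` is onto: the orthogonal projection of `(z, 0)` to the
graph of `A` is a point `(x, A x)` for which `⟪A y, A x⟫ = ⟪y, z - x⟫` for all `y`. -/
theorem exists_inner_eq_inner_sub (A : X →ₗ.[ℂ] Y) (hA : A.IsClosed) (z : X) :
    ∃ x : A.domain, ∀ y : A.domain, ⟪A y, A x⟫_ℂ = ⟪(y : X), z - x⟫_ℂ := by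
  let K : Submodule ℂ (WithLp 2 (X × Y)) :=
    A.graph.comap (WithLp.linearEquiv 2 ℂ (X × Y)).toLinearMap
  have hK : IsClosed (K : Set (WithLp 2 (X × Y))) :=
    IsClosed.preimage (WithLp.prod_continuous_ofLp 2 X Y) hA
  have : CompleteSpace K := hK.completeSpace_coe
  obtain ⟨p, hp, q, hq, h⟩ := K.exists_add_mem_mem_orthogonal (WithLp.toLp 2 (z, (0 : Y)))
  obtain ⟨x, hx1, hx2⟩ := (LinearPMap.mem_graph_iff A).1 (show p.ofLp ∈ A.graph from hp)
  refine ⟨x, fun y => ?_⟩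
  have hy := (K.mem_orthogonal q).1 hq (WithLp.toLp 2 ((y : X), A y)) (A.mem_graph y)
  obtain rfl : q = WithLp.toLp 2 (z, (0 : Y)) - p := by rw [h]; abel
  rw [WithLp.prod_inner_apply] at hy
  simp only [WithLp.ofLp_sub, Prod.fst_sub, Prod.snd_sub, ← hx1, ← hx2, zero_sub,
    inner_neg_right] at hy
  exact (neg_add_eq_zero.1 ((add_comm _ _).trans hy))

variable {A : X →ₗ.[ℂ] Y} {T : X →ₗ.[ℂ] X}

/-- The operator of the closed form `(y, x) ↦ ⟪A y, A x⟫` is self-adjoint. Density of its domain is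
not assumed: it follows from the surjectivity of `T + 1`. -/
theorem isSelfAdjoint_of_form (hA : A.IsClosed)
    (hT : ∀ x z, (x, z) ∈ T.graph ↔
      ∃ hx : x ∈ A.domain, ∀ y : A.domain, ⟪A y, A ⟨x, hx⟩⟫_ℂ = ⟪(y : X), z⟫_ℂ) :
    IsSelfAdjoint T := by
  have hform : ∀ x : T.domain, ∃ hx : (x : X) ∈ A.domain, ∀ y : A.domain,
      ⟪A y, A ⟨x, hx⟩⟫_ℂ = ⟪(y : X), T x⟫_ℂ := fun x => (hT x (T x)).1 (T.mem_graph x)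
  have hsurj : ∀ z : X, ∃ x : T.domain, T x + x = z := fun z => by
    obtain ⟨x, hx⟩ := exists_inner_eq_inner_sub A hA z
    obtain ⟨x', h1, h2⟩ := (LinearPMap.mem_graph_iff T).1 ((hT x (z - x)).2 ⟨x.2, hx⟩)
    exact ⟨x', by rw [h2, h1]; simp⟩
  have hsymm : T.IsFormalAdjoint T := fun x y => by
    obtain ⟨hx, hx'⟩ := hform x
    obtain ⟨hy, hy'⟩ := hform y
    rw [← hy' ⟨x, hx⟩, ← inner_conj_symm, ← hx' ⟨y, hy⟩, inner_conj_symm]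
  have hdense : Dense (T.domain : Set X) := by
    rw [Submodule.dense_iff_topologicalClosure_eq_top, Submodule.topologicalClosure_eq_top_iff,
      Submodule.eq_bot_iff]
    intro z hz
    obtain ⟨x, rfl⟩ := hsurj z
    obtain ⟨hx, hx'⟩ := hform x
    have h0 := (T.domain.mem_orthogonal _).1 hz x x.2
    rw [inner_add_right, ← hx' ⟨x, hx⟩, inner_self_eq_norm_sq_to_K, inner_self_eq_norm_sq_to_K]
      at h0
    have h1 : ‖A ⟨x, hx⟩‖ ^ 2 + ‖(x : X)‖ ^ 2 = 0 := Complex.ofReal_injective (by simpa using h0)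
    have h2 : (x : X) = 0 := by
      have : ‖(x : X)‖ ^ 2 = 0 := by nlinarith [sq_nonneg ‖A ⟨x, hx⟩‖, sq_nonneg ‖(x : X)‖]
      simpa using this
    have h3 : x = 0 := Subtype.ext h2
    rw [h3]; simp
  rw [LinearPMap.isSelfAdjoint_def]
  refine le_antisymm ?_ (hsymm.le_adjoint hdense)
  have hle := hsymm.le_adjoint hdense
  -- for `y ∈ dom T†` pick `x` with `(T + 1) x = (T† + 1) y`; then `y - x` is orthogonal to the
  -- range of `T + 1`
  have hdom : T.adjoint.domain ≤ T.domain := fun y hy => by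
    obtain ⟨x, hx⟩ := hsurj (T.adjoint ⟨y, hy⟩ + y)
    have hTx : T.adjoint ⟨x, hle.1 x.2⟩ = T x := (hle.2 (x := x) rfl).symm
    obtain ⟨t, ht⟩ := hsurj (y - x)
    have hadj := LinearPMap.adjoint_isFormalAdjoint hdense
      (⟨y, hy⟩ - ⟨x, hle.1 x.2⟩ : T.adjoint.domain) t
    rw [LinearPMap.map_sub, hTx] at hadj
    have he : T.adjoint ⟨y, hy⟩ - T x = -(y - x) := by
      rw [neg_sub, sub_eq_sub_iff_add_eq_add, ← hx]; abel
    rw [he, inner_neg_left] at hadj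
    have h0 : ⟪y - x, y - (x : X)⟫_ℂ = 0 := by
      nth_rewrite 2 [← ht]
      rw [inner_add_right]
      have : ((⟨y, hy⟩ - ⟨x, hle.1 x.2⟩ : T.adjoint.domain) : X) = y - x := rfl
      rw [this] at hadj
      rw [← hadj]; ring
    rw [inner_self_eq_zero, sub_eq_zero] at h0
    rw [h0]; exact x.2
  exact ⟨hdom, fun y x hyx => (hle.2 hyx.symm).symm⟩

/-- The operator of a closed form is the only self-adjoint operator that represents the form. -/
theorem isSelfAdjoint_and_form_iff_eq (hA : A.IsClosed)
    (hT : ∀ x z, (x, z) ∈ T.graph ↔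
      ∃ hx : x ∈ A.domain, ∀ y : A.domain, ⟪A y, A ⟨x, hx⟩⟫_ℂ = ⟪(y : X), z⟫_ℂ)
    (H : X →ₗ.[ℂ] X) :
    (IsSelfAdjoint H ∧ ∀ x : H.domain, ∃ hx : (x : X) ∈ A.domain, ∀ y : A.domain,
      ⟪A y, A ⟨x, hx⟩⟫_ℂ = ⟪(y : X), H x⟫_ℂ) ↔ H = T := by
  have hsT := isSelfAdjoint_of_form hA hT
  constructor
  · rintro ⟨hsH, hH⟩
    have hle : H ≤ T := LinearPMap.le_of_le_graph fun p hp => by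
      obtain ⟨x, h1, h2⟩ := (LinearPMap.mem_graph_iff H).1 hp
      obtain ⟨x', z⟩ := p
      obtain rfl : (x : X) = x' := h1
      obtain rfl : H x = z := h2
      exact (hT _ _).2 (hH x)
    refine le_antisymm hle ?_
    -- taking adjoints reverses the inclusion `H ≤ T`
    have hform : H.IsFormalAdjoint T := fun x t => by
      have hTx : H x = T ⟨x, hle.1 x.2⟩ := hle.2 rfl
      have := LinearPMap.adjoint_isFormalAdjoint hsT.dense_domain
      rw [LinearPMap.isSelfAdjoint_def.1 hsT] at this
      rw [hTx]; exact this _ _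
    have := hform.le_adjoint hsH.dense_domain
    rwa [LinearPMap.isSelfAdjoint_def.1 hsH] at this
  · rintro rfl
    exact ⟨hsT, fun x => (hT x (H x)).1 (H.mem_graph x)⟩

end FormOperator

section Interval

open ComplexConjugate

variable {ℓ : ℝ}

/-! ### Primitives and integration by parts on an interval -/

theorem continuousOn_primitive {g : ℝ → ℂ} (hg : IntegrableOn g (Ioo 0 ℓ)) :
    ContinuousOn (fun x => ∫ y in Ioo (0 : ℝ) x, g y) (Icc 0 ℓ) := by
  refine (intervalIntegral.continuousOn_primitive
    ((integrableOn_Icc_iff_integrableOn_Ioo).2 hg)).congr fun x _ => ?_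
  exact integral_Ioc_eq_integral_Ioo.symm

/-- Integration by parts for two primitives, by Fubini's theorem on the two triangles that make up
the square `(0, ℓ)²`. -/
theorem integral_primitive_mul_add {g q : ℝ → ℂ} (hg : IntegrableOn g (Ioo 0 ℓ))
    (hq : IntegrableOn q (Ioo 0 ℓ)) :
    (∫ x in Ioo 0 ℓ, (∫ y in Ioo 0 x, g y) * q x) + ∫ x in Ioo 0 ℓ, g x * ∫ y in Ioo 0 x, q y
      = (∫ x in Ioo 0 ℓ, g x) * ∫ x in Ioo 0 ℓ, q x := by
  set μ : Measure ℝ := volume.restrict (Ioo (0 : ℝ) ℓ) with hμ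
  have hprod : Integrable (fun p : ℝ × ℝ => g p.1 * q p.2) (μ.prod μ) := hg.mul_prod hq
  have hS : MeasurableSet {p : ℝ × ℝ | p.1 < p.2} := measurableSet_lt measurable_fst measurable_snd
  have h1 : ∫ p, {p : ℝ × ℝ | p.1 < p.2}.indicator (fun p => g p.1 * q p.2) p ∂μ.prod μ
      = ∫ x in Ioo 0 ℓ, (∫ y in Ioo 0 x, g y) * q x := by
    rw [integral_prod_symm _ (hprod.indicator hS)]
    refine setIntegral_congr_fun measurableSet_Ioo fun x hx => ?_
    have : (fun y => {p : ℝ × ℝ | p.1 < p.2}.indicator (fun p => g p.1 * q p.2) (y, x))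
        = (Iio x).indicator (fun y => g y * q x) := by
      funext y; simp [indicator]
    rw [this, integral_indicator measurableSet_Iio, integral_mul_const, hμ,
      Measure.restrict_restrict measurableSet_Iio]
    congr 3
    ext y; simp only [mem_inter_iff, mem_Iio, mem_Ioo]
    exact ⟨fun h => ⟨h.2.1, h.1⟩, fun h => ⟨h.2, h.1, h.2.trans hx.2⟩⟩
  have h2 : ∫ p, {p : ℝ × ℝ | p.1 < p.2}ᶜ.indicator (fun p => g p.1 * q p.2) p ∂μ.prod μ
      = ∫ x in Ioo 0 ℓ, g x * ∫ y in Ioo 0 x, q y := by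
    rw [integral_prod _ (hprod.indicator hS.compl)]
    refine setIntegral_congr_fun measurableSet_Ioo fun x hx => ?_
    have : (fun y => {p : ℝ × ℝ | p.1 < p.2}ᶜ.indicator (fun p => g p.1 * q p.2) (x, y))
        = (Iic x).indicator (fun y => g x * q y) := by
      funext y; simp [indicator]
    rw [this, integral_indicator measurableSet_Iic, integral_const_mul, hμ,
      Measure.restrict_restrict measurableSet_Iic, ← integral_Ioc_eq_integral_Ioo]
    congr 3
    ext y; simp only [mem_inter_iff, mem_Iic, mem_Ioc, mem_Ioo]
    exact ⟨fun h => ⟨h.2.1, h.1⟩, fun h => ⟨h.2, h.1, h.2.trans_lt hx.2⟩⟩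
  rw [← h1, ← h2, ← integral_add (hprod.indicator hS) (hprod.indicator hS.compl),
    ← integral_prod_mul]
  congr 1
  funext p
  exact congrFun (indicator_self_add_compl _ _) p

theorem integral_mul_add_mul_of_primitive {g q : ℝ → ℂ} (hg : IntegrableOn g (Ioo 0 ℓ))
    (hq : IntegrableOn q (Ioo 0 ℓ)) (c d : ℂ) :
    (∫ x in Ioo 0 ℓ, g x * (d + ∫ y in Ioo 0 x, q y))
        + ∫ x in Ioo 0 ℓ, (c + ∫ y in Ioo 0 x, g y) * q x
      = (c + ∫ x in Ioo 0 ℓ, g x) * (d + ∫ x in Ioo 0 ℓ, q x) - c * d := by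
  have hb : ∀ {g q : ℝ → ℂ}, IntegrableOn g (Ioo 0 ℓ) → IntegrableOn q (Ioo 0 ℓ) →
      IntegrableOn (fun x => (∫ y in Ioo 0 x, g y) * q x) (Ioo 0 ℓ) := fun hg hq => by
    obtain ⟨C, hC⟩ := isCompact_Icc.exists_bound_of_continuousOn (continuousOn_primitive hg)
    refine Integrable.bdd_mul (c := C) hq ?_ ?_
    · exact ((continuousOn_primitive hg).mono Ioo_subset_Icc_self).aestronglyMeasurable
        measurableSet_Ioo
    · exact (ae_restrict_iff' measurableSet_Ioo).2
        (Eventually.of_forall fun x hx => hC x (Ioo_subset_Icc_self hx))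
  have hb' : IntegrableOn (fun x => g x * ∫ y in Ioo 0 x, q y) (Ioo 0 ℓ) := by
    simpa only [mul_comm] using hb hq hg
  simp only [mul_add, add_mul]
  rw [integral_add (hg.mul_const d) hb', integral_add (hq.const_mul c) (hb hg hq),
    integral_mul_const, integral_const_mul]
  linear_combination integral_primitive_mul_add hg hq

/-- An `H¹` function is the primitive of its weak derivative that starts at the end value at `0`. -/
theorem IsWeakDeriv.ae_eq_and_endValue (hℓ : 0 < ℓ) {f g : L2 ℓ} (h : IsWeakDeriv f g) :
    ((f : ℝ → ℂ) =ᵐ[volume.restrict (Ioo (0 : ℝ) ℓ)]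
      fun x => endValue f 0 + ∫ y in Ioo 0 x, (g : ℝ → ℂ) y) ∧
    endValue f ℓ = endValue f 0 + ∫ y in Ioo 0 ℓ, (g : ℝ → ℂ) y := by
  set G : ℝ → ℂ := fun x => ∫ y in Ioo (0 : ℝ) x, (g : ℝ → ℂ) y with hG
  have hGc : ContinuousOn G (Icc 0 ℓ) := continuous_primitive g
  have hGi : Integrable G (volume.restrict (Ioo (0 : ℝ) ℓ)) :=
    (hGc.integrableOn_Icc).mono_set Ioo_subset_Icc_self
  have hGs : ∀ φ : ℝ → ℝ, IsTest ℓ φ →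
      Integrable (fun x => deriv φ x • G x) (volume.restrict (Ioo (0 : ℝ) ℓ)) := fun φ hφ => by
    obtain ⟨C, hC⟩ := hφ.2.1.deriv.exists_bound_of_continuous hφ.continuous_deriv
    exact hGi.bdd_smul C hφ.continuous_deriv.aestronglyMeasurable (Eventually.of_forall hC)
  obtain ⟨c, hc⟩ := ae_const_of_test hℓ ((integrable_L2 f).sub hGi) (fun φ hφ => by
    have e : ∫ x in Ioo (0 : ℝ) ℓ, deriv φ x • ((f : ℝ → ℂ) - G) x
        = ∫ x in Ioo (0 : ℝ) ℓ, (deriv φ x • f x - deriv φ x • G x) := by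
      simp only [Pi.sub_apply, smul_sub]
    rw [e, integral_sub (integrable_smul_L2 _ hφ.continuous_deriv hφ.2.1.deriv) (hGs φ hφ),
      h φ hφ, integral_deriv_smul_primitive g hφ, sub_self])
  have hcG : ContinuousOn (fun x => c + G x) (Icc 0 ℓ) := continuousOn_const.add hGc
  have hfG : (f : ℝ → ℂ) =ᵐ[volume.restrict (Ioo (0 : ℝ) ℓ)] fun x => c + G x := by
    filter_upwards [hc] with x hx
    rw [← hx, Pi.sub_apply, sub_add_cancel]
  have hval : ∀ x ∈ Icc 0 ℓ, endValue f x = c + G x := fun x hx =>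
    HasEndValue.endValue_eq hℓ hx ⟨fun x => c + G x, hcG.mono Ioo_subset_Icc_self, hfG,
      (hcG x hx).mono Ioo_subset_Icc_self⟩
  have h0 : endValue f 0 = c := by
    rw [hval 0 ⟨le_rfl, hℓ.le⟩]; simp [hG]
  exact ⟨by rw [h0]; exact hfG, by rw [h0]; exact hval ℓ ⟨hℓ.le, le_rfl⟩⟩

/-- Integration by parts in `H¹(0, ℓ)`. -/
theorem IsWeakDeriv.inner_add_inner (hℓ : 0 < ℓ) {f g p q : L2 ℓ} (h : IsWeakDeriv f g)
    (h' : IsWeakDeriv p q) : ⟪g, p⟫_ℂ + ⟪f, q⟫_ℂ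
      = conj (endValue f ℓ) * endValue p ℓ - conj (endValue f 0) * endValue p 0 := by
  obtain ⟨hf, hfℓ⟩ := h.ae_eq_and_endValue hℓ
  obtain ⟨hp, hpℓ⟩ := h'.ae_eq_and_endValue hℓ
  have hg : IntegrableOn (fun x => conj ((g : ℝ → ℂ) x)) (Ioo 0 ℓ) :=
    (LinearIsometryEquiv.integrable_comp_iff Complex.conjLIE).2 (integrable_L2 g)
  have key := integral_mul_add_mul_of_primitive hg (integrable_L2 q) (conj (endValue f 0))
    (endValue p 0)
  simp only [integral_conj] at key
  rw [hfℓ, hpℓ, map_add, ← key, L2.inner_def, L2.inner_def]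
  congr 1
  · refine integral_congr_ae ?_
    filter_upwards [hp] with x hx
    rw [hx, RCLike.inner_apply, mul_comm]
  · refine integral_congr_ae ?_
    filter_upwards [hf] with x hx
    rw [hx, RCLike.inner_apply, mul_comm, map_add]

/-! ### Continuous functions and primitives as elements of `L²(0, ℓ)` -/

theorem memLp_of_continuousOn {φ : ℝ → ℂ} (hφ : ContinuousOn φ (Icc 0 ℓ)) :
    MemLp φ 2 (volume.restrict (Ioo (0 : ℝ) ℓ)) := by
  obtain ⟨C, hC⟩ := isCompact_Icc.exists_bound_of_continuousOn hφ
  exact MemLp.of_bound ((hφ.mono Ioo_subset_Icc_self).aestronglyMeasurable measurableSet_Ioo) C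
    ((ae_restrict_iff' measurableSet_Ioo).2
      (Eventually.of_forall fun x hx => hC x (Ioo_subset_Icc_self hx)))

/-- Every `g ∈ L²(0, ℓ)` is a weak derivative. -/
theorem exists_isWeakDeriv_right (g : L2 ℓ) : ∃ f : L2 ℓ, IsWeakDeriv f g := by
  have hm := memLp_of_continuousOn (continuous_primitive g)
  refine ⟨hm.toLp, fun φ hφ => ?_⟩
  rw [← integral_deriv_smul_primitive g hφ]
  refine integral_congr_ae ?_
  filter_upwards [hm.coeFn_toLp] with x hx
  rw [hx]

/-- A continuous function on the line as an element of `L²(0, ℓ)`. -/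
def ofCont (ℓ : ℝ) (φ : C(ℝ, ℂ)) : L2 ℓ :=
  (memLp_of_continuousOn (ℓ := ℓ) φ.continuous.continuousOn).toLp

theorem coeFn_ofCont (φ : C(ℝ, ℂ)) :
    (ofCont ℓ φ : ℝ → ℂ) =ᵐ[volume.restrict (Ioo (0 : ℝ) ℓ)] φ := MemLp.coeFn_toLp _

theorem endValue_ofCont (hℓ : 0 < ℓ) (φ : C(ℝ, ℂ)) {x : ℝ} (hx : x ∈ Icc 0 ℓ) :
    endValue (ofCont ℓ φ) x = φ x :=
  HasEndValue.endValue_eq hℓ hx ⟨φ, φ.continuous.continuousOn, coeFn_ofCont φ,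
    φ.continuous.continuousWithinAt⟩

theorem isWeakDeriv_ofCont {φ ψ : C(ℝ, ℂ)} (h : ∀ x, HasDerivAt φ (ψ x) x) :
    IsWeakDeriv (ofCont ℓ φ) (ofCont ℓ ψ) := by
  intro θ hθ
  rcases le_or_gt ℓ 0 with hℓ | hℓ
  · simp [Ioo_eq_empty_of_le hℓ]
  have e1 : ∫ x in Ioo (0 : ℝ) ℓ, deriv θ x • (ofCont ℓ φ : ℝ → ℂ) x
      = ∫ x in (0 : ℝ)..ℓ, deriv θ x • φ x := by
    rw [intervalIntegral.integral_of_le hℓ.le, integral_Ioc_eq_integral_Ioo]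
    refine integral_congr_ae ?_
    filter_upwards [coeFn_ofCont φ] with x hx
    rw [hx]
  have e2 : ∫ x in Ioo (0 : ℝ) ℓ, θ x • (ofCont ℓ ψ : ℝ → ℂ) x
      = ∫ x in (0 : ℝ)..ℓ, θ x • ψ x := by
    rw [intervalIntegral.integral_of_le hℓ.le, integral_Ioc_eq_integral_Ioo]
    refine integral_congr_ae ?_
    filter_upwards [coeFn_ofCont ψ] with x hx
    rw [hx]
  have hθ0 : ∀ x, x ∉ Ioo (0 : ℝ) ℓ → θ x = 0 := fun x hx =>
    image_eq_zero_of_notMem_tsupport fun h => hx (hθ.2.2 h)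
  rw [e1, e2, intervalIntegral.integral_smul_deriv_eq_deriv_smul
    (fun x _ => ((hθ.1.differentiable (by simp)) x).hasDerivAt) (fun x _ => h x)
    (hθ.continuous_deriv.intervalIntegrable _ _) (ψ.continuous.intervalIntegrable _ _),
    hθ0 ℓ (by simp), hθ0 0 (by simp)]
  simp

theorem inner_ofCont (φ : C(ℝ, ℂ)) (f : L2 ℓ) :
    ⟪ofCont ℓ φ, f⟫_ℂ = ∫ x in Ioo (0 : ℝ) ℓ, conj (φ x) * (f : ℝ → ℂ) x := by
  rw [L2.inner_def]
  refine integral_congr_ae ?_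
  filter_upwards [coeFn_ofCont φ] with x hx
  rw [hx, RCLike.inner_apply, mul_comm]

/-! ### Test functions -/

theorem IsTest.isTest_deriv {φ : ℝ → ℝ} (h : IsTest ℓ φ) : IsTest ℓ (deriv φ) :=
  ⟨(contDiff_infty_iff_deriv.1 h.1).2, h.2.1.deriv, tsupport_deriv_subset.trans h.2.2⟩

theorem IsTest.eq_zero {φ : ℝ → ℝ} (h : IsTest ℓ φ) {x : ℝ} (hx : x ∉ Ioo (0 : ℝ) ℓ) : φ x = 0 :=
  image_eq_zero_of_notMem_tsupport fun hx' => hx (h.2.2 hx')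

/-- A test function as a complex-valued continuous function. -/
def IsTest.toC {φ : ℝ → ℝ} (h : IsTest ℓ φ) : C(ℝ, ℂ) :=
  ⟨fun x => (φ x : ℂ), Complex.continuous_ofReal.comp h.continuous⟩

theorem IsTest.isWeakDeriv {φ : ℝ → ℝ} (h : IsTest ℓ φ) :
    IsWeakDeriv (ofCont ℓ h.toC) (ofCont ℓ h.isTest_deriv.toC) :=
  isWeakDeriv_ofCont fun x => ((h.1.differentiable (by simp)) x).hasDerivAt.ofReal_comp

theorem IsTest.inner_toC {φ : ℝ → ℝ} (h : IsTest ℓ φ) (f : L2 ℓ) :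
    ⟪ofCont ℓ h.toC, f⟫_ℂ = ∫ x in Ioo (0 : ℝ) ℓ, φ x • (f : ℝ → ℂ) x := by
  rw [inner_ofCont]
  simp [IsTest.toC]

theorem IsTest.endValue_toC (hℓ : 0 < ℓ) {φ : ℝ → ℝ} (h : IsTest ℓ φ) {x : ℝ}
    (hx : x = 0 ∨ x = ℓ) : endValue (ofCont ℓ h.toC) x = 0 := by
  rw [endValue_ofCont hℓ]
  · have : φ x = 0 := h.eq_zero (by rcases hx with rfl | rfl <;> simp)
    simp [IsTest.toC, this]
  · rcases hx with rfl | rfl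
    · exact ⟨le_rfl, hℓ.le⟩
    · exact ⟨hℓ.le, le_rfl⟩

theorem isWeakDeriv_iff_inner {f g : L2 ℓ} : IsWeakDeriv f g ↔
    ∀ (φ : ℝ → ℝ) (h : IsTest ℓ φ), ⟪ofCont ℓ h.isTest_deriv.toC, f⟫_ℂ = -⟪ofCont ℓ h.toC, g⟫_ℂ :=
  forall₂_congr fun φ h => by rw [h.isTest_deriv.inner_toC, h.inner_toC]

theorem exists_isTest_integral_eq_one (hℓ : 0 < ℓ) : ∃ χ : ℝ → ℝ, IsTest ℓ χ ∧ ∫ x, χ x = 1 := by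
  let b : ContDiffBump (ℓ / 2) := ⟨ℓ / 8, ℓ / 4, by linarith, by linarith⟩
  refine ⟨b.normed volume, ⟨b.contDiff_normed, b.hasCompactSupport_normed, ?_⟩,
    b.integral_normed⟩
  rw [b.tsupport_normed_eq]
  intro x hx
  rw [Metric.mem_closedBall, Real.dist_eq, abs_le] at hx
  change -(ℓ / 4) ≤ x - ℓ / 2 ∧ x - ℓ / 2 ≤ ℓ / 4 at hx
  constructor <;> linarith [hx.1, hx.2]

/-- A test function with mean zero is the derivative of a test function. -/
theorem IsTest.exists_deriv_eq {θ : ℝ → ℝ} (h : IsTest ℓ θ) (h0 : ∫ x, θ x = 0) :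
    ∃ φ : ℝ → ℝ, IsTest ℓ φ ∧ deriv φ = θ := by
  rcases (tsupport θ).eq_empty_or_nonempty with he | hne
  · rw [tsupport_eq_empty_iff] at he
    subst he
    exact ⟨0, h, by funext x; simp⟩
  set α := sInf (tsupport θ)
  set β := sSup (tsupport θ)
  have hK : IsCompact (tsupport θ) := h.2.1
  have hα : 0 < α := (h.2.2 (hK.sInf_mem hne)).1
  have hβ : β < ℓ := (h.2.2 (hK.sSup_mem hne)).2
  have hθ0 : ∀ x, x ∉ Icc α β → θ x = 0 := fun x hx =>
    image_eq_zero_of_notMem_tsupport fun hx' =>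
      hx ⟨csInf_le hK.bddBelow hx', le_csSup hK.bddAbove hx'⟩
  set φ : ℝ → ℝ := fun x => ∫ y in (0 : ℝ)..x, θ y with hφ
  have hφd : ∀ x, HasDerivAt φ (θ x) x := fun x =>
    intervalIntegral.integral_hasDerivAt_right (h.continuous.intervalIntegrable _ _)
      (h.continuous.stronglyMeasurableAtFilter _ _) h.continuous.continuousAt
  have hφ' : deriv φ = θ := funext fun x => (hφd x).deriv
  have hφs : ContDiff ℝ ∞ φ := by
    rw [contDiff_infty_iff_deriv, hφ']
    exact ⟨fun x => (hφd x).differentiableAt, h.1⟩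
  have hφ0 : ∀ x, x ∉ Icc α β → φ x = 0 := fun x hx => by
    rcases lt_or_ge x α with hxα | hxα
    · refine intervalIntegral.integral_zero_ae (Eventually.of_forall fun y hy => hθ0 y ?_)
      intro hy'
      rcases le_total 0 x with h0 | h0
      · rw [uIoc_of_le h0] at hy; linarith [hy.2, hy'.1]
      · rw [uIoc_of_ge h0] at hy; linarith [hy.2, hy'.1]
    · have hxβ : β < x := not_le.1 fun h' => hx ⟨hxα, h'⟩
      have hx0 : 0 ≤ x := by linarith
      rw [hφ]
      simp only
      rw [intervalIntegral.integral_of_le hx0, ← h0]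
      refine setIntegral_eq_integral_of_forall_compl_eq_zero fun y hy => hθ0 y fun hy' => ?_
      exact hy ⟨by linarith [hy'.1], by linarith [hy'.2]⟩
  have hts : tsupport φ ⊆ Icc α β :=
    closure_minimal (fun x hx => by by_contra h'; exact hx (hφ0 x h')) isClosed_Icc
  exact ⟨φ, ⟨hφs, HasCompactSupport.of_support_subset_isCompact isCompact_Icc
    ((subset_tsupport _).trans hts), fun x hx =>
      ⟨by linarith [(hts hx).1], by linarith [(hts hx).2]⟩⟩, hφ'⟩

/-- An `L²` function whose second derivative in the sense of distributions is an `L²` function is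
in `H²`. -/
theorem exists_isWeakDeriv_isWeakDeriv (hℓ : 0 < ℓ) {f r : L2 ℓ}
    (h : ∀ (φ : ℝ → ℝ) (hφ : IsTest ℓ φ),
      ⟪ofCont ℓ hφ.isTest_deriv.isTest_deriv.toC, f⟫_ℂ = ⟪ofCont ℓ hφ.toC, r⟫_ℂ) :
    ∃ g : L2 ℓ, IsWeakDeriv f g ∧ IsWeakDeriv g r := by
  obtain ⟨R, hR⟩ := exists_isWeakDeriv_right r
  obtain ⟨S, hS⟩ := exists_isWeakDeriv_right R
  obtain ⟨χ, hχ, hχ1⟩ := exists_isTest_integral_eq_one hℓ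
  -- `f - S` has vanishing second derivative, hence the constant first derivative `-C`; the constant
  -- is found by testing with `χ`, which has mean one
  set C : ℂ := ⟪ofCont ℓ hχ.isTest_deriv.toC, f - S⟫_ℂ with hC
  let one : C(ℝ, ℂ) := ContinuousMap.const ℝ 1
  have hone : IsWeakDeriv (ofCont ℓ one) 0 := by
    have := isWeakDeriv_ofCont (ℓ := ℓ) (φ := one) (ψ := 0) fun x => hasDerivAt_const x (1 : ℂ)
    convert this using 1
    refine Lp.ext ?_
    filter_upwards [coeFn_ofCont (ℓ := ℓ) 0,
      Lp.coeFn_zero ℂ 2 (volume.restrict (Ioo (0 : ℝ) ℓ))] with x h1 h2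
    rw [h1, h2]; rfl
  have hlin : IsWeakDeriv (f - S) (-C • ofCont ℓ one) := by
    rw [isWeakDeriv_iff_inner]
    intro θ hθ
    set c : ℝ := ∫ x, θ x with hc
    have hψt : IsTest ℓ (fun x => θ x - c * χ x) := by
      refine ⟨hθ.1.sub (contDiff_const.mul hχ.1), hθ.2.1.sub (hχ.2.1.mul_left (f := fun _ => c)),
        ?_⟩
      refine (tsupport_sub _ _).trans (union_subset hθ.2.2 ?_)
      exact (tsupport_mul_subset_right (f := fun _ => c)).trans hχ.2.2
    have hθi := hθ.continuous.integrable_of_hasCompactSupport hθ.2.1 (μ := volume)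
    have hχi := hχ.continuous.integrable_of_hasCompactSupport hχ.2.1 (μ := volume)
    -- `θ - c χ` has mean zero, so that its derivative is a second derivative of a test function
    obtain ⟨φ, hφ, hφ'⟩ := hψt.exists_deriv_eq (by
      rw [integral_sub hθi (hχi.const_mul c), integral_const_mul, hχ1, mul_one, sub_self])
    have hdd : ofCont ℓ hφ.isTest_deriv.isTest_deriv.toC
        = ofCont ℓ hθ.isTest_deriv.toC - (c : ℂ) • ofCont ℓ hχ.isTest_deriv.toC := by
      refine Lp.ext ?_
      filter_upwards [coeFn_ofCont (ℓ := ℓ) hφ.isTest_deriv.isTest_deriv.toC,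
        coeFn_ofCont (ℓ := ℓ) hθ.isTest_deriv.toC, coeFn_ofCont (ℓ := ℓ) hχ.isTest_deriv.toC,
        Lp.coeFn_sub (ofCont ℓ hθ.isTest_deriv.toC) ((c : ℂ) • ofCont ℓ hχ.isTest_deriv.toC),
        Lp.coeFn_smul (c : ℂ) (ofCont ℓ hχ.isTest_deriv.toC)] with x h1 h2 h3 h4 h5
      rw [h4, Pi.sub_apply, h5, Pi.smul_apply, h1, h2, h3]
      have : deriv (deriv φ) x = deriv θ x - c * deriv χ x := by
        rw [hφ', deriv_fun_sub ((hθ.1.differentiable (by simp)) x)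
          (((hχ.1.differentiable (by simp)) x).const_mul c), deriv_const_mul_field]
      simp [IsTest.toC, this]
    have hz : ⟪ofCont ℓ hφ.isTest_deriv.isTest_deriv.toC, f - S⟫_ℂ = 0 := by
      rw [inner_sub_right, h φ hφ, isWeakDeriv_iff_inner.1 hS _ hφ.isTest_deriv,
        isWeakDeriv_iff_inner.1 hR _ hφ]
      ring
    have hθ1 : ⟪ofCont ℓ hθ.toC, ofCont ℓ one⟫_ℂ = c := by
      have hsupp : ∫ x in Ioo (0 : ℝ) ℓ, (θ x : ℂ) = ∫ x, (θ x : ℂ) :=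
        setIntegral_eq_integral_of_forall_compl_eq_zero fun x hx => by
          rw [hθ.eq_zero hx, Complex.ofReal_zero]
      rw [hθ.inner_toC, hc, ← integral_complex_ofReal, ← hsupp]
      refine integral_congr_ae ?_
      filter_upwards [coeFn_ofCont (ℓ := ℓ) one] with x hx
      rw [hx]
      simp [one]
    rw [hdd, inner_sub_left, inner_smul_left, sub_eq_zero, Complex.conj_ofReal] at hz
    rw [hz, inner_smul_right, hθ1, ← hC]
    ring
  refine ⟨R + -C • ofCont ℓ one, ?_, ?_⟩
  · have := hS.add hlin
    rwa [add_sub_cancel] at this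
  · have := hR.add (hone.smul (-C))
    rwa [smul_zero, add_zero] at this

end Interval

section Sobolev

open ComplexConjugate

variable {ℓ : ℝ}

/-! ### Higher order Sobolev spaces: Green's identities and traces -/

theorem MemH.isWeakDeriv : ∀ {n : ℕ} {f : L2 ℓ}, MemH (n + 1) f →
    IsWeakDeriv (Beam.wderivs n f) (Beam.wderivs (n + 1) f)
  | 0, f, ⟨g, hg, _⟩ => by
    simp only [Beam.wderivs]
    rwa [hg.wderiv_eq]
  | n + 1, f, ⟨g, hg, hm⟩ => by
    have := hm.isWeakDeriv
    rwa [← hg.wderiv_eq] at this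

theorem IsWeakDeriv.memH_one {f g : L2 ℓ} (h : IsWeakDeriv f g) :
    MemH 1 f ∧ wderivs 1 f = g := ⟨⟨g, h, trivial⟩, h.wderiv_eq⟩

theorem IsWeakDeriv.memH_two {f g r : L2 ℓ} (h : IsWeakDeriv f g) (h' : IsWeakDeriv g r) :
    MemH 2 f ∧ wderivs 1 f = g ∧ wderivs 2 f = r :=
  ⟨⟨g, h, r, h', trivial⟩, h.wderiv_eq, by rw [wderivs, h.wderiv_eq, wderivs, h'.wderiv_eq]; rfl⟩

theorem wderivs_wderivs (m : ℕ) : ∀ (n : ℕ) (f : L2 ℓ),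
    wderivs m (wderivs n f) = wderivs (n + m) f
  | 0, f => by rw [zero_add]; rfl
  | n + 1, f => by
    rw [wderivs, wderivs_wderivs m n, show n + 1 + m = (n + m) + 1 by ring, wderivs]

theorem MemH.of_wderivs {m : ℕ} : ∀ {n : ℕ} {f : L2 ℓ}, MemH n f → MemH m (Beam.wderivs n f) →
    MemH (n + m) f
  | 0, f, _, h => by rw [zero_add]; exact h
  | n + 1, f, ⟨g, hg, hn⟩, h => by
    rw [show n + 1 + m = (n + m) + 1 by ring]
    rw [Beam.wderivs, hg.wderiv_eq] at h
    exact ⟨g, hg, hn.of_wderivs h⟩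

/-- Green's identity of order one. -/
theorem inner_wderivs_one (hℓ : 0 < ℓ) {p f : L2 ℓ} (hp : MemH 1 p) (hf : MemH 1 f) :
    ⟪wderivs 1 p, f⟫_ℂ + ⟪p, wderivs 1 f⟫_ℂ
      = conj (endValue p ℓ) * endValue f ℓ - conj (endValue p 0) * endValue f 0 :=
  IsWeakDeriv.inner_add_inner hℓ hp.isWeakDeriv hf.isWeakDeriv

/-- Green's identity of order two. -/
theorem inner_wderivs_two (hℓ : 0 < ℓ) {p f : L2 ℓ} (hp : MemH 2 p) (hf : MemH 2 f) :
    ⟪p, wderivs 2 f⟫_ℂ - ⟪wderivs 2 p, f⟫_ℂ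
      = conj (endValue p ℓ) * endValue (wderivs 1 f) ℓ
          - conj (endValue (wderivs 1 p) ℓ) * endValue f ℓ
        - (conj (endValue p 0) * endValue (wderivs 1 f) 0
          - conj (endValue (wderivs 1 p) 0) * endValue f 0) := by
  have h1 := IsWeakDeriv.inner_add_inner hℓ (hp.of_le one_le_two).isWeakDeriv hf.isWeakDeriv
  have h2 := IsWeakDeriv.inner_add_inner hℓ hp.isWeakDeriv (hf.of_le one_le_two).isWeakDeriv
  simp only [wderivs.eq_1] at h1 h2
  linear_combination h1 - h2

/-- Green's identity for the bending energy. -/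
theorem inner_wderivs_two_wderivs_two (hℓ : 0 < ℓ) {p f : L2 ℓ} (hp : MemH 2 p) (hf : MemH 4 f) :
    ⟪wderivs 2 p, wderivs 2 f⟫_ℂ = ⟪p, wderivs 4 f⟫_ℂ
      + (conj (endValue (wderivs 1 p) ℓ) * endValue (wderivs 2 f) ℓ
          - conj (endValue p ℓ) * endValue (wderivs 3 f) ℓ
        - (conj (endValue (wderivs 1 p) 0) * endValue (wderivs 2 f) 0
          - conj (endValue p 0) * endValue (wderivs 3 f) 0)) := by
  have h := inner_wderivs_two hℓ hp (MemH.wderivs (n := 2) (m := 2) hf)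
  rw [wderivs_wderivs, wderivs_wderivs] at h
  linear_combination -h

/-- Green's identity for the stretching energy. -/
theorem inner_wderivs_one_wderivs_one (hℓ : 0 < ℓ) {p f : L2 ℓ} (hp : MemH 1 p) (hf : MemH 2 f) :
    ⟪wderivs 1 p, wderivs 1 f⟫_ℂ = -⟪p, wderivs 2 f⟫_ℂ
      + (conj (endValue p ℓ) * endValue (wderivs 1 f) ℓ
        - conj (endValue p 0) * endValue (wderivs 1 f) 0) := by
  have h := inner_wderivs_one hℓ hp (MemH.wderivs (n := 1) (m := 1) hf)
  rw [wderivs_wderivs] at h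
  linear_combination h

/-- Hermite interpolation by a cubic polynomial. -/
theorem exists_memH_two_endValue (hℓ : 0 < ℓ) (α β γ δ : ℂ) : ∃ f : L2 ℓ, MemH 2 f ∧
    endValue f 0 = α ∧ endValue (wderivs 1 f) 0 = β ∧
    endValue f ℓ = γ ∧ endValue (wderivs 1 f) ℓ = δ := by
  have hℓ' : (ℓ : ℂ) ≠ 0 := Complex.ofReal_ne_zero.2 hℓ.ne'
  set r : ℂ := 3 * (γ - α) / ℓ ^ 2 - (2 * β + δ) / ℓ with hr
  set s : ℂ := -2 * (γ - α) / ℓ ^ 3 + (β + δ) / ℓ ^ 2 with hs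
  let φ : C(ℝ, ℂ) := ⟨fun x => α + β * x + r * (x : ℂ) ^ 2 + s * (x : ℂ) ^ 3, by fun_prop⟩
  let φ' : C(ℝ, ℂ) := ⟨fun x => β + 2 * r * x + 3 * s * (x : ℂ) ^ 2, by fun_prop⟩
  let φ'' : C(ℝ, ℂ) := ⟨fun x => 2 * r + 6 * s * x, by fun_prop⟩
  have hX : ∀ x : ℝ, HasDerivAt (fun x : ℝ => (x : ℂ)) 1 x := fun x =>
    (hasDerivAt_id x).ofReal_comp
  have h1 : ∀ x, HasDerivAt φ (φ' x) x := fun x => by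
    have := ((((hX x).const_mul β).const_add α).add (((hX x).pow 2).const_mul r)).add
      (((hX x).pow 3).const_mul s)
    refine this.congr_deriv ?_
    simp only [φ', ContinuousMap.coe_mk]
    push_cast
    ring
  have h2 : ∀ x, HasDerivAt φ' (φ'' x) x := fun x => by
    have := (((hX x).const_mul (2 * r)).const_add β).add (((hX x).pow 2).const_mul (3 * s))
    refine this.congr_deriv ?_
    simp only [φ'', ContinuousMap.coe_mk]
    push_cast
    ring
  obtain ⟨hm, he, -⟩ := (isWeakDeriv_ofCont (ℓ := ℓ) h1).memH_two (isWeakDeriv_ofCont h2)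
  have h0 : (0 : ℝ) ∈ Icc 0 ℓ := ⟨le_rfl, hℓ.le⟩
  have hL : ℓ ∈ Icc 0 ℓ := ⟨hℓ.le, le_rfl⟩
  refine ⟨ofCont ℓ φ, hm, ?_, ?_, ?_, ?_⟩
  · rw [endValue_ofCont hℓ _ h0]; simp [φ]
  · rw [he, endValue_ofCont hℓ _ h0]; simp [φ']
  · rw [endValue_ofCont hℓ _ hL]
    simp only [φ, ContinuousMap.coe_mk, hr, hs]
    field_simp
    ring
  · rw [he, endValue_ofCont hℓ _ hL]
    simp only [φ', ContinuousMap.coe_mk, hr, hs]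
    field_simp
    ring

/-- The end values on `H¹` are continuous in the graph norm of the weak derivative: they are
given by inner products, by Green's identity with an interpolating polynomial. -/
theorem exists_inner_eq_endValue_one (hℓ : 0 < ℓ) {x : ℝ} (hx : x = 0 ∨ x = ℓ) :
    ∃ p q : L2 ℓ, ∀ f : L2 ℓ, MemH 1 f → endValue f x = ⟪p, wderivs 1 f⟫_ℂ + ⟪q, f⟫_ℂ := by
  rcases hx with rfl | hx
  · obtain ⟨p, hp, h1, -, h3, -⟩ := exists_memH_two_endValue hℓ (-1) 0 0 0
    refine ⟨p, wderivs 1 p, fun f hf => ?_⟩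
    have := inner_wderivs_one hℓ (hp.of_le one_le_two) hf
    rw [h1, h3] at this
    simp only [map_neg, map_zero, map_one] at this
    linear_combination -this
  · subst hx
    obtain ⟨p, hp, h1, -, h3, -⟩ := exists_memH_two_endValue hℓ 0 0 1 0
    refine ⟨p, wderivs 1 p, fun f hf => ?_⟩
    have := inner_wderivs_one hℓ (hp.of_le one_le_two) hf
    rw [h1, h3] at this
    simp only [map_zero, map_one] at this
    linear_combination -this

/-- The end values of orders zero and one on `H²` are continuous in the graph norm of the second
weak derivative. -/
theorem exists_inner_eq_endValue_two (hℓ : 0 < ℓ) {x : ℝ} (hx : x = 0 ∨ x = ℓ) {k : ℕ}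
    (hk : k < 2) : ∃ p q : L2 ℓ, ∀ f : L2 ℓ, MemH 2 f →
      endValue (wderivs k f) x = ⟪p, wderivs 2 f⟫_ℂ + ⟪q, f⟫_ℂ := by
  have key : ∀ α β γ δ : ℂ, ∃ p q : L2 ℓ, ∀ f : L2 ℓ, MemH 2 f →
      ⟪p, wderivs 2 f⟫_ℂ + ⟪q, f⟫_ℂ
        = conj γ * endValue (wderivs 1 f) ℓ - conj δ * endValue f ℓ
          - (conj α * endValue (wderivs 1 f) 0 - conj β * endValue f 0) := fun α β γ δ => by
    obtain ⟨p, hp, h1, h2, h3, h4⟩ := exists_memH_two_endValue hℓ α β γ δ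
    refine ⟨p, -wderivs 2 p, fun f hf => ?_⟩
    have := inner_wderivs_two hℓ hp hf
    rw [h1, h2, h3, h4] at this
    rw [← this, inner_neg_left, sub_eq_add_neg]
  obtain rfl | rfl : k = 0 ∨ k = 1 := by omega
  · rcases hx with rfl | hx
    · obtain ⟨p, q, h⟩ := key 0 1 0 0
      exact ⟨p, q, fun f hf => by rw [h f hf]; simp [wderivs.eq_1]⟩
    · subst hx
      obtain ⟨p, q, h⟩ := key 0 0 0 (-1)
      exact ⟨p, q, fun f hf => by rw [h f hf]; simp [wderivs.eq_1]⟩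
  · rcases hx with rfl | hx
    · obtain ⟨p, q, h⟩ := key (-1) 0 0 0
      exact ⟨p, q, fun f hf => by rw [h f hf]; simp⟩
    · subst hx
      obtain ⟨p, q, h⟩ := key 0 0 1 0
      exact ⟨p, q, fun f hf => by rw [h f hf]; simp⟩

section Limits

variable {ι : Type*} {L : Filter ι} [L.NeBot] {F : ι → L2 ℓ} {f r : L2 ℓ}

/-- Closedness of the first weak derivative, and convergence of the end values. -/
theorem MemH.of_tendsto_one (hℓ : 0 < ℓ) (hF : ∀ n, MemH 1 (F n)) (hf : Tendsto F L (𝓝 f))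
    (hr : Tendsto (fun n => Beam.wderivs 1 (F n)) L (𝓝 r)) :
    (MemH 1 f ∧ Beam.wderivs 1 f = r) ∧ ∀ x, x = 0 ∨ x = ℓ →
      Tendsto (fun n => endValue (F n) x) L (𝓝 (endValue f x)) := by
  have hm : MemH 1 f ∧ Beam.wderivs 1 f = r := by
    refine IsWeakDeriv.memH_one (isWeakDeriv_iff_inner.2 fun φ hφ => ?_)
    refine tendsto_nhds_unique (tendsto_const_nhds.inner hf) ?_
    refine ((tendsto_const_nhds.inner hr).neg).congr fun n => ?_
    exact (isWeakDeriv_iff_inner.1 (hF n).isWeakDeriv φ hφ).symm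
  refine ⟨hm, fun x hx => ?_⟩
  obtain ⟨p, q, h⟩ := exists_inner_eq_endValue_one hℓ hx
  rw [h f hm.1, hm.2]
  exact ((tendsto_const_nhds.inner hr).add (tendsto_const_nhds.inner hf)).congr
    fun n => (h (F n) (hF n)).symm

/-- Closedness of the second weak derivative, and convergence of the end values. -/
theorem MemH.of_tendsto_two (hℓ : 0 < ℓ) (hF : ∀ n, MemH 2 (F n)) (hf : Tendsto F L (𝓝 f))
    (hr : Tendsto (fun n => Beam.wderivs 2 (F n)) L (𝓝 r)) :
    (MemH 2 f ∧ Beam.wderivs 2 f = r) ∧ ∀ k < 2, ∀ x, x = 0 ∨ x = ℓ →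
      Tendsto (fun n => endValue (Beam.wderivs k (F n)) x) L
        (𝓝 (endValue (Beam.wderivs k f) x)) := by
  have hm : MemH 2 f ∧ Beam.wderivs 2 f = r := by
    obtain ⟨g, hg, hgr⟩ := exists_isWeakDeriv_isWeakDeriv hℓ (f := f) (r := r) fun φ hφ => by
      refine tendsto_nhds_unique (tendsto_const_nhds.inner hf) ?_
      refine (tendsto_const_nhds.inner hr).congr fun n => ?_
      have h1 := isWeakDeriv_iff_inner.1 ((hF n).of_le one_le_two).isWeakDeriv _ hφ.isTest_deriv
      have h2 := isWeakDeriv_iff_inner.1 (hF n).isWeakDeriv _ hφ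
      rw [h2, neg_neg] at h1
      exact h1.symm
    exact ⟨(hg.memH_two hgr).1, (hg.memH_two hgr).2.2⟩
  refine ⟨hm, fun k hk x hx => ?_⟩
  obtain ⟨p, q, h⟩ := exists_inner_eq_endValue_two hℓ hx hk
  rw [h f hm.1, hm.2]
  exact ((tendsto_const_nhds.inner hr).add (tendsto_const_nhds.inner hf)).congr
    fun n => (h (F n) (hF n)).symm

end Limits

end Sobolev

open ComplexConjugate

/-! ### Complexified orthonormal bases -/

theorem cvec_dotProduct_cvec (p q : EuclideanSpace ℝ (Fin 3)) :
    cvec p ⬝ᵥ cvec q = ((⟪p, q⟫_ℝ : ℝ) : ℂ) := by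
  simp [cvec, dotProduct, PiLp.inner_apply, mul_comm]

theorem star_cvec (p : EuclideanSpace ℝ (Fin 3)) : star (cvec p) = cvec p := by
  funext m; simp [cvec]

/-- A real orthonormal basis of `ℝ³` expands every vector of `ℂ³`. -/
theorem cvec_sum_dotProduct_smul {i j k : EuclideanSpace ℝ (Fin 3)}
    (h : Orthonormal ℝ ![i, j, k]) (x : Fin 3 → ℂ) :
    (cvec i ⬝ᵥ x) • cvec i + (cvec j ⬝ᵥ x) • cvec j + (cvec k ⬝ᵥ x) • cvec k = x := by
  let M : Matrix (Fin 3) (Fin 3) ℂ := Matrix.of fun m => cvec (![i, j, k] m)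
  have hM : M * M.transpose = 1 := by
    ext m l
    have : (M * M.transpose) m l = cvec (![i, j, k] m) ⬝ᵥ cvec (![i, j, k] l) := rfl
    rw [this, cvec_dotProduct_cvec, orthonormal_iff_ite.1 h m l, Matrix.one_apply]
    split_ifs <;> simp
  have hM' : M.transpose.mulVec (M.mulVec x) = x := by
    rw [Matrix.mulVec_mulVec, mul_eq_one_comm.1 hM, Matrix.one_mulVec]
  nth_rewrite 4 [← hM']
  funext l
  simp [M, Matrix.mulVec, dotProduct, Fin.sum_univ_three]
  ring

open scoped ComplexOrder in
theorem eq_zero_of_star_dotProduct_self {d : Fin 3 → ℂ} (h : star d ⬝ᵥ d = 0) : d = 0 :=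
  dotProduct_star_self_eq_zero.1 h

namespace Frame

variable {V E : Type*} {F : Frame V E}

theorem dotProduct_basis (e : E) :
    (cvec (F.i e) ⬝ᵥ cvec (F.i e) = 1 ∧ cvec (F.j e) ⬝ᵥ cvec (F.j e) = 1 ∧
      cvec (F.k e) ⬝ᵥ cvec (F.k e) = 1) ∧
    (cvec (F.i e) ⬝ᵥ cvec (F.j e) = 0 ∧ cvec (F.j e) ⬝ᵥ cvec (F.i e) = 0) ∧
    (cvec (F.i e) ⬝ᵥ cvec (F.k e) = 0 ∧ cvec (F.k e) ⬝ᵥ cvec (F.i e) = 0) ∧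
    (cvec (F.j e) ⬝ᵥ cvec (F.k e) = 0 ∧ cvec (F.k e) ⬝ᵥ cvec (F.j e) = 0) := by
  have h := orthonormal_iff_ite.1 (F.orthonormal e)
  simp only [cvec_dotProduct_cvec]
  refine ⟨⟨?_, ?_, ?_⟩, ⟨?_, ?_⟩, ⟨?_, ?_⟩, ?_, ?_⟩
  · exact congrArg Complex.ofReal (h 0 0)
  · exact congrArg Complex.ofReal (h 1 1)
  · exact congrArg Complex.ofReal (h 2 2)
  · simpa using h 0 1
  · simpa using h 1 0
  · simpa using h 0 2
  · simpa using h 2 0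
  · simpa using h 1 2
  · simpa using h 2 1

/-- The complexified basis of an edge is orthonormal for the Hermitian product of `ℂ³`. -/
theorem star_dotProduct_basis (e : E) (x y z x' y' z' : ℂ) :
    star (x • cvec (F.i e) + y • cvec (F.j e) + z • cvec (F.k e)) ⬝ᵥ
      (x' • cvec (F.i e) + y' • cvec (F.j e) + z' • cvec (F.k e))
      = conj x * x' + conj y * y' + conj z * z' := by
  obtain ⟨⟨h1, h2, h3⟩, ⟨h4, h5⟩, ⟨h6, h7⟩, h8, h9⟩ := F.dotProduct_basis e
  simp only [star_add, star_smul, star_cvec, add_dotProduct, dotProduct_add, smul_dotProduct,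
    dotProduct_smul, h1, h2, h3, h4, h5, h6, h7, h8, h9, smul_eq_mul]
  simp only [starRingEnd_apply]
  ring

/-! ### The ends of an edge -/

theorem origin_ne_terminus (e : E) : F.origin e ≠ F.terminus e := fun h => by
  have h1 := F.axis e
  rw [h, sub_self, eq_comm, smul_eq_zero] at h1
  have h2 : ‖F.i e‖ = 1 := (F.orthonormal e).1 0
  rcases h1 with h1 | h1
  · exact (F.len_pos e).ne' h1
  · simp [h1] at h2

theorem coord_origin (e : E) : F.coord (F.origin e) e = 0 := if_pos rfl

theorem coord_terminus (e : E) : F.coord (F.terminus e) e = F.len e :=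
  if_neg (origin_ne_terminus e)

/-! ### Splitting of the vertex conditions of a planar frame -/

theorem Agree.map {A B : Type*} {𝔳 : V} {x : E → A} (g : A → B) (hx : F.Agree 𝔳 x) :
    F.Agree 𝔳 fun e => g (x e) := fun e e' h h' => congrArg g (hx e e' h h')

theorem Agree.map₂ {A B C : Type*} {𝔳 : V} {x : E → A} {y : E → B} (g : A → B → C)
    (hx : F.Agree 𝔳 x) (hy : F.Agree 𝔳 y) : F.Agree 𝔳 fun e => g (x e) (y e) :=
  fun e e' h h' => by
    change g (x e) (y e) = g (x e') (y e')
    rw [hx e e' h h', hy e e' h h']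

theorem IsPlanar.cvec_dotProduct_normal {n : EuclideanSpace ℝ (Fin 3)} (h : F.IsPlanar n) (e : E) :
    cvec n ⬝ᵥ cvec (F.i e) = 0 ∧ cvec n ⬝ᵥ cvec (F.j e) = 0 ∧ cvec n ⬝ᵥ cvec n = 1 := by
  obtain ⟨⟨h1, h2, h3⟩, ⟨h4, h5⟩, ⟨h6, h7⟩, h8, h9⟩ := F.dotProduct_basis e
  rw [h.2.2 e] at h3 h7 h9
  exact ⟨h7, h9, h3⟩

/-- In a planar frame, vectors agree at a vertex if and only if their normal components and
their in-plane components do. -/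
theorem IsPlanar.agree_iff {n : EuclideanSpace ℝ (Fin 3)} (h : F.IsPlanar n) (𝔳 : V)
    (x y z : E → ℂ) :
    F.Agree 𝔳 (fun e => x e • cvec (F.i e) + y e • cvec (F.j e) + z e • cvec (F.k e)) ↔
      F.Agree 𝔳 z ∧ F.Agree 𝔳 (fun e => x e • cvec (F.i e) + y e • cvec (F.j e)) := by
  constructor
  · intro hA
    have hz : F.Agree 𝔳 z := by
      convert hA.map (fun p => cvec n ⬝ᵥ p) using 1
      funext e
      obtain ⟨h1, h2, h3⟩ := h.cvec_dotProduct_normal e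
      simp [h.2.2 e, h1, h2, h3]
    refine ⟨hz, ?_⟩
    convert hA.map₂ (fun p t => p - t • cvec n) hz using 1
    funext e
    simp [h.2.2 e]
  · rintro ⟨hz, hp⟩
    convert hp.map₂ (fun p t => p + t • cvec n) hz using 1
    funext e
    rw [h.2.2 e]

section Vertex

variable [Fintype E]

theorem Balanced.map {A B : Type*} [AddCommGroup A] [Module ℂ A] [AddCommGroup B] [Module ℂ B]
    {𝔳 : V} {x : E → A} (g : A →ₗ[ℂ] B) (hx : F.Balanced 𝔳 x) :
    F.Balanced 𝔳 fun e => g (x e) := by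
  unfold Balanced at *
  simp only [← map_smul, ← map_sum, hx, map_zero]

section Planar

variable {n : EuclideanSpace ℝ (Fin 3)}

/-- In a planar frame, vectors are balanced at a vertex if and only if their normal components
and their in-plane components are. -/
theorem IsPlanar.balanced_iff (h : F.IsPlanar n) (𝔳 : V) (x y z : E → ℂ) :
    F.Balanced 𝔳 (fun e => x e • cvec (F.i e) + y e • cvec (F.j e) + z e • cvec (F.k e)) ↔
      F.Balanced 𝔳 z ∧ F.Balanced 𝔳 (fun e => x e • cvec (F.i e) + y e • cvec (F.j e)) := by
  have hn : ∀ z : E → ℂ, F.Balanced 𝔳 z → F.Balanced 𝔳 fun e => z e • cvec n := fun z hz =>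
    hz.map (LinearMap.toSpanSingleton ℂ (Fin 3 → ℂ) (cvec n))
  constructor
  · intro hA
    have hz : F.Balanced 𝔳 z := by
      convert hA.map (dotProductBilin ℂ ℂ (cvec n)) using 1
      funext e
      obtain ⟨h1, h2, h3⟩ := h.cvec_dotProduct_normal e
      simp [h.2.2 e, h1, h2, h3]
    refine ⟨hz, ?_⟩
    convert hA.add ((hn z hz).smul (-1)) using 1
    funext e
    simp [h.2.2 e]
  · rintro ⟨hz, hp⟩
    convert hp.add (hn z hz) using 1
    funext e
    rw [h.2.2 e]; rfl

theorem balanced_neg_iff {A : Type*} [AddCommGroup A] [Module ℂ A] {𝔳 : V} {x : E → A} :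
    F.Balanced 𝔳 (fun e => -x e) ↔ F.Balanced 𝔳 x := by
  unfold Balanced
  simp only [smul_neg, Finset.sum_neg_distrib, neg_eq_zero]

omit [Fintype E] in
theorem IsPlanar.displacementCont_iff (h : F.IsPlanar n) (Ψ : F.State) (𝔳 : V) :
    F.DisplacementCont Ψ 𝔳 ↔
      F.DisplacementCont₁ (Ψ 0) 𝔳 ∧ F.DisplacementCont₂ (Ψ 1) (Ψ 2) 𝔳 :=
  h.agree_iff 𝔳 _ _ _

omit [Fintype E] in
theorem IsPlanar.rotationCont_iff (h : F.IsPlanar n) (Ψ : F.State) (𝔳 : V) :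
    F.RotationCont Ψ 𝔳 ↔ F.RotationCont₁ (Ψ 0) (Ψ 3) 𝔳 ∧ F.RotationCont₂ (Ψ 1) 𝔳 := by
  have := h.agree_iff 𝔳 (F.val 𝔳 0 (Ψ 3)) (fun e => -F.val 𝔳 1 (Ψ 0) e) (F.val 𝔳 1 (Ψ 1))
  simp only [neg_smul, ← sub_eq_add_neg] at this
  exact this.trans and_comm

theorem IsPlanar.forceBalance_iff (h : F.IsPlanar n) (Ψ : F.State) (𝔳 : V) :
    F.ForceBalance Ψ 𝔳 ↔ F.ForceBalance₁ (Ψ 0) 𝔳 ∧ F.ForceBalance₂ (Ψ 1) (Ψ 2) 𝔳 := by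
  have := h.balanced_iff 𝔳 (fun e => F.c e * F.val 𝔳 1 (Ψ 2) e)
    (fun e => -(F.b e * F.val 𝔳 3 (Ψ 1) e)) (fun e => -(F.a e * F.val 𝔳 3 (Ψ 0) e))
  simp only [neg_smul, ← sub_eq_add_neg] at this
  exact this.trans (and_congr_left' balanced_neg_iff)

theorem IsPlanar.momentBalance_iff (h : F.IsPlanar n) (Ψ : F.State) (𝔳 : V) :
    F.MomentBalance Ψ 𝔳 ↔ F.MomentBalance₁ (Ψ 0) (Ψ 3) 𝔳 ∧ F.MomentBalance₂ (Ψ 1) 𝔳 := by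
  have := h.balanced_iff 𝔳 (fun e => F.d e * F.val 𝔳 1 (Ψ 3) e)
    (fun e => -(F.a e * F.val 𝔳 2 (Ψ 0) e)) (fun e => F.b e * F.val 𝔳 2 (Ψ 1) e)
  simp only [neg_smul, ← sub_eq_add_neg] at this
  exact this.trans and_comm

end Planar

end Vertex

/-! ### Green's identity on a frame -/

variable (F)

/-- The displacement of the end `𝔳` of the edge `e`. -/
def disp (Ψ : F.State) (𝔳 : V) (e : E) : Fin 3 → ℂ :=
  F.val 𝔳 0 (Ψ 2) e • cvec (F.i e) + F.val 𝔳 0 (Ψ 1) e • cvec (F.j e)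
    + F.val 𝔳 0 (Ψ 0) e • cvec (F.k e)

/-- The infinitesimal rotation of the end `𝔳` of the edge `e`. -/
def rot (Ψ : F.State) (𝔳 : V) (e : E) : Fin 3 → ℂ :=
  F.val 𝔳 0 (Ψ 3) e • cvec (F.i e) - F.val 𝔳 1 (Ψ 0) e • cvec (F.j e)
    + F.val 𝔳 1 (Ψ 1) e • cvec (F.k e)

/-- The contribution of the edge `e` to the balance of forces at its end `𝔳`, without the sign
`s_𝔳^e`. -/
def force (Ψ : F.State) (𝔳 : V) (e : E) : Fin 3 → ℂ :=
  (F.c e * F.val 𝔳 1 (Ψ 2) e) • cvec (F.i e)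
    - (F.b e * F.val 𝔳 3 (Ψ 1) e) • cvec (F.j e) - (F.a e * F.val 𝔳 3 (Ψ 0) e) • cvec (F.k e)

/-- The contribution of the edge `e` to the balance of moments at its end `𝔳`, without the sign
`s_𝔳^e`. -/
def moment (Ψ : F.State) (𝔳 : V) (e : E) : Fin 3 → ℂ :=
  (F.d e * F.val 𝔳 1 (Ψ 3) e) • cvec (F.i e)
    - (F.a e * F.val 𝔳 2 (Ψ 0) e) • cvec (F.j e) + (F.b e * F.val 𝔳 2 (Ψ 1) e) • cvec (F.k e)

/-- The boundary term of Green's identity: the work of the force and of the moment of `Ψ` in the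
displacement and in the rotation of `Φ`. -/
def work (Φ Ψ : F.State) (𝔳 : V) (e : E) : ℂ :=
  star (F.disp Φ 𝔳 e) ⬝ᵥ F.force Ψ 𝔳 e + star (F.rot Φ 𝔳 e) ⬝ᵥ F.moment Ψ 𝔳 e

/-- The edgewise action `(v, w, u, η) ↦ (a v'''', b w'''', -c u'', -d η'')`. -/
def action (Ψ : F.State) : F.State :=
  WithLp.toLp 2 ![WithLp.toLp 2 fun e => (F.a e : ℂ) • wderivs 4 (Ψ 0 e),
    WithLp.toLp 2 fun e => (F.b e : ℂ) • wderivs 4 (Ψ 1 e),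
    WithLp.toLp 2 fun e => -(F.c e : ℂ) • wderivs 2 (Ψ 2 e),
    WithLp.toLp 2 fun e => -(F.d e : ℂ) • wderivs 2 (Ψ 3 e)]

variable {F}

theorem work_eq (Φ Ψ : F.State) (𝔳 : V) (e : E) : F.work Φ Ψ 𝔳 e =
    F.a e * (conj (F.val 𝔳 1 (Φ 0) e) * F.val 𝔳 2 (Ψ 0) e
        - conj (F.val 𝔳 0 (Φ 0) e) * F.val 𝔳 3 (Ψ 0) e)
      + F.b e * (conj (F.val 𝔳 1 (Φ 1) e) * F.val 𝔳 2 (Ψ 1) e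
        - conj (F.val 𝔳 0 (Φ 1) e) * F.val 𝔳 3 (Ψ 1) e)
      + F.c e * (conj (F.val 𝔳 0 (Φ 2) e) * F.val 𝔳 1 (Ψ 2) e)
      + F.d e * (conj (F.val 𝔳 0 (Φ 3) e) * F.val 𝔳 1 (Ψ 3) e) := by
  unfold work disp rot force moment
  simp only [sub_eq_add_neg, ← neg_smul]
  rw [star_dotProduct_basis, star_dotProduct_basis, map_neg]
  ring

variable [Fintype E]

/-- Green's identity, edge by edge. -/
theorem energy_eq_inner_add_sum {Φ Ψ : F.State}
    (hΦ : F.InH 2 (Φ 0) ∧ F.InH 2 (Φ 1) ∧ F.InH 1 (Φ 2) ∧ F.InH 1 (Φ 3))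
    (hΨ : F.InH 4 (Ψ 0) ∧ F.InH 4 (Ψ 1) ∧ F.InH 2 (Ψ 2) ∧ F.InH 2 (Ψ 3)) :
    F.energy Φ Ψ = ⟪Φ, F.action Ψ⟫_ℂ
      + ∑ e, (F.work Φ Ψ (F.terminus e) e - F.work Φ Ψ (F.origin e) e) := by
  have hin : ⟪Φ, F.action Ψ⟫_ℂ = ∑ e, (F.a e * ⟪Φ 0 e, wderivs 4 (Ψ 0 e)⟫_ℂ
      + F.b e * ⟪Φ 1 e, wderivs 4 (Ψ 1 e)⟫_ℂ - F.c e * ⟪Φ 2 e, wderivs 2 (Ψ 2 e)⟫_ℂ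
      - F.d e * ⟪Φ 3 e, wderivs 2 (Ψ 3 e)⟫_ℂ) := by
    rw [PiLp.inner_apply, Fin.sum_univ_four]
    simp only [PiLp.inner_apply, ← Finset.sum_add_distrib]
    refine Finset.sum_congr rfl fun e _ => ?_
    simp only [action, Matrix.cons_val, inner_smul_right]
    ring
  rw [hin, energy, ← Finset.sum_add_distrib]
  refine Finset.sum_congr rfl fun e _ => ?_
  have hℓ := F.len_pos e
  rw [inner_wderivs_two_wderivs_two hℓ (hΦ.1 e) (hΨ.1 e),
    inner_wderivs_two_wderivs_two hℓ (hΦ.2.1 e) (hΨ.2.1 e),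
    inner_wderivs_one_wderivs_one hℓ (hΦ.2.2.1 e) (hΨ.2.2.1 e),
    inner_wderivs_one_wderivs_one hℓ (hΦ.2.2.2 e) (hΨ.2.2.2 e), work_eq, work_eq]
  simp only [val, coord_origin, coord_terminus]
  simp only [wderivs.eq_1]
  ring

open Classical in
/-- The joints that are ends of an edge. -/
def joints (F : Frame V E) : Finset V :=
  Finset.univ.image F.origin ∪ Finset.univ.image F.terminus

open Classical in
/-- A sum over the ends of the edges is a sum over the joints. -/
theorem sum_terminus_sub_origin (X : V → E → ℂ) :
    ∑ e, (X (F.terminus e) e - X (F.origin e) e)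
      = -∑ 𝔳 ∈ F.joints, ∑ e with F.Incident e 𝔳, F.sign 𝔳 e * X 𝔳 e := by
  simp only [Finset.sum_filter]
  rw [Finset.sum_comm, ← Finset.sum_neg_distrib]
  refine Finset.sum_congr rfl fun e _ => ?_
  have ho : F.origin e ∈ F.joints :=
    Finset.mem_union_left _ (Finset.mem_image_of_mem _ (Finset.mem_univ e))
  have ht : F.terminus e ∈ F.joints :=
    Finset.mem_union_right _ (Finset.mem_image_of_mem _ (Finset.mem_univ e))
  have hne := F.origin_ne_terminus e
  rw [Finset.sum_eq_add_of_mem _ _ ho ht hne]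
  · simp only [Incident, sign, hne, true_or, or_true, if_true, if_false]
    ring
  · rintro 𝔳 - ⟨h1, h2⟩
    exact if_neg fun h => h.elim (fun h => h1 h.symm) fun h => h2 h.symm

open Classical in
theorem sum_star_dotProduct_of_agree {𝔳 : V} {x y : E → Fin 3 → ℂ} {d : Fin 3 → ℂ}
    (hx : ∀ e, F.Incident e 𝔳 → x e = d) :
    ∑ e with F.Incident e 𝔳, F.sign 𝔳 e * (star (x e) ⬝ᵥ y e)
      = star d ⬝ᵥ ∑ e with F.Incident e 𝔳, F.sign 𝔳 e • y e := by
  rw [dotProduct_sum]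
  refine Finset.sum_congr rfl fun e he => ?_
  rw [hx e (Finset.mem_filter.1 he).2, dotProduct_smul, smul_eq_mul]

open Classical in
theorem Agree.sum_star_dotProduct_eq_zero {𝔳 : V} {x y : E → Fin 3 → ℂ} (hx : F.Agree 𝔳 x)
    (hy : F.Balanced 𝔳 y) :
    ∑ e with F.Incident e 𝔳, F.sign 𝔳 e * (star (x e) ⬝ᵥ y e) = 0 := by
  by_cases h : ∃ e, F.Incident e 𝔳
  · obtain ⟨e₀, h₀⟩ := h
    rw [sum_star_dotProduct_of_agree (d := x e₀) fun e he => hx e e₀ he h₀, show _ = _ from hy,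
      dotProduct_zero]
  · refine Finset.sum_eq_zero fun e he => absurd ⟨e, (Finset.mem_filter.1 he).2⟩ h

open Classical in
theorem sum_sign_mul_work (Φ Ψ : F.State) (𝔳 : V) :
    ∑ e with F.Incident e 𝔳, F.sign 𝔳 e * F.work Φ Ψ 𝔳 e
      = (∑ e with F.Incident e 𝔳, F.sign 𝔳 e * (star (F.disp Φ 𝔳 e) ⬝ᵥ F.force Ψ 𝔳 e))
        + ∑ e with F.Incident e 𝔳, F.sign 𝔳 e * (star (F.rot Φ 𝔳 e) ⬝ᵥ F.moment Ψ 𝔳 e) := by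
  simp only [work, mul_add, Finset.sum_add_distrib]

/-- If the forces and the moments balance then the boundary terms cancel. -/
theorem energy_eq_inner {Φ Ψ : F.State} (hΦ : F.InFormDomain Φ)
    (hΨ : F.InH 4 (Ψ 0) ∧ F.InH 4 (Ψ 1) ∧ F.InH 2 (Ψ 2) ∧ F.InH 2 (Ψ 3))
    (hb : ∀ 𝔳, F.ForceBalance Ψ 𝔳 ∧ F.MomentBalance Ψ 𝔳) :
    F.energy Φ Ψ = ⟪Φ, F.action Ψ⟫_ℂ := by
  rw [energy_eq_inner_add_sum hΦ.1 hΨ, sum_terminus_sub_origin, Finset.sum_eq_zero]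
  · simp
  · intro 𝔳 _
    have h1 : F.Agree 𝔳 (F.disp Φ 𝔳) ∧ F.Agree 𝔳 (F.rot Φ 𝔳) := hΦ.2 𝔳
    have h2 : F.Balanced 𝔳 (F.force Ψ 𝔳) ∧ F.Balanced 𝔳 (F.moment Ψ 𝔳) := hb 𝔳
    rw [sum_sign_mul_work, h1.1.sum_star_dotProduct_eq_zero h2.1,
      h1.2.sum_star_dotProduct_eq_zero h2.2, add_zero]

/-! ### States with prescribed displacement and rotation at one joint -/

omit [Fintype E] in
open Classical in
/-- Values and slopes at the joint `𝔳` can be prescribed independently on the edges, with zero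
values and slopes at the other joints. -/
theorem exists_inH_two_val (𝔳 : V) (α β : E → ℂ) : ∃ f : F.Field, F.InH 2 f ∧
    ∀ 𝔴 e, F.Incident e 𝔴 → F.val 𝔴 0 f e = (if 𝔴 = 𝔳 then α e else 0) ∧
      F.val 𝔴 1 f e = (if 𝔴 = 𝔳 then β e else 0) := by
  choose f hf h1 h2 h3 h4 using fun e => exists_memH_two_endValue (F.len_pos e)
    (if F.origin e = 𝔳 then α e else 0) (if F.origin e = 𝔳 then β e else 0)
    (if F.terminus e = 𝔳 then α e else 0) (if F.terminus e = 𝔳 then β e else 0)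
  refine ⟨WithLp.toLp 2 f, hf, ?_⟩
  rintro 𝔴 e (rfl | rfl)
  · exact ⟨by rw [val, coord_origin]; exact h1 e, by rw [val, coord_origin]; exact h2 e⟩
  · exact ⟨by rw [val, coord_terminus]; exact h3 e, by rw [val, coord_terminus]; exact h4 e⟩

omit [Fintype E] in
open Classical in
/-- The joint `𝔳` can be displaced by `d` and rotated by `r` with all other joints clamped. -/
theorem exists_inFormDomain_disp_rot (𝔳 : V) (d r : Fin 3 → ℂ) : ∃ Φ : F.State,
    F.InFormDomain Φ ∧ ∀ 𝔴 e, F.Incident e 𝔴 → F.disp Φ 𝔴 e = (if 𝔴 = 𝔳 then d else 0) ∧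
      F.rot Φ 𝔴 e = (if 𝔴 = 𝔳 then r else 0) := by
  obtain ⟨v, hv, hv'⟩ := F.exists_inH_two_val 𝔳 (fun e => cvec (F.k e) ⬝ᵥ d)
    (fun e => -(cvec (F.j e) ⬝ᵥ r))
  obtain ⟨w, hw, hw'⟩ := F.exists_inH_two_val 𝔳 (fun e => cvec (F.j e) ⬝ᵥ d)
    (fun e => cvec (F.k e) ⬝ᵥ r)
  obtain ⟨u, hu, hu'⟩ := F.exists_inH_two_val 𝔳 (fun e => cvec (F.i e) ⬝ᵥ d) 0
  obtain ⟨η, hη, hη'⟩ := F.exists_inH_two_val 𝔳 (fun e => cvec (F.i e) ⬝ᵥ r) 0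
  have key : ∀ 𝔴 e, F.Incident e 𝔴 →
      F.disp (WithLp.toLp 2 ![v, w, u, η]) 𝔴 e = (if 𝔴 = 𝔳 then d else 0) ∧
      F.rot (WithLp.toLp 2 ![v, w, u, η]) 𝔴 e = (if 𝔴 = 𝔳 then r else 0) := by
    intro 𝔴 e he
    have hd := cvec_sum_dotProduct_smul (F.orthonormal e) d
    have hr := cvec_sum_dotProduct_smul (F.orthonormal e) r
    simp only [disp, rot, Matrix.cons_val]
    rw [(hv' 𝔴 e he).1, (hv' 𝔴 e he).2, (hw' 𝔴 e he).1, (hw' 𝔴 e he).2, (hu' 𝔴 e he).1,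
      (hη' 𝔴 e he).1]
    split_ifs with h
    · exact ⟨hd, by rw [neg_smul, sub_neg_eq_add]; exact hr⟩
    · simp
  refine ⟨WithLp.toLp 2 ![v, w, u, η], ⟨⟨hv, hw, fun e => (hu e).of_le one_le_two,
    fun e => (hη e).of_le one_le_two⟩, fun 𝔴 => ⟨fun e e' he he' => ?_, fun e e' he he' => ?_⟩⟩,
    key⟩
  · exact (key 𝔴 e he).1.trans (key 𝔴 e' he').1.symm
  · exact (key 𝔴 e he).2.trans (key 𝔴 e' he').2.symm

/-- The balance conditions are the natural boundary conditions of the energy form. -/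
theorem balance_of_energy_eq_inner {Ψ : F.State}
    (hΨ : F.InH 4 (Ψ 0) ∧ F.InH 4 (Ψ 1) ∧ F.InH 2 (Ψ 2) ∧ F.InH 2 (Ψ 3))
    (h : ∀ Φ, F.InFormDomain Φ → F.energy Φ Ψ = ⟪Φ, F.action Ψ⟫_ℂ) (𝔳 : V) :
    F.ForceBalance Ψ 𝔳 ∧ F.MomentBalance Ψ 𝔳 := by
  classical
  have key : ∀ d r : Fin 3 → ℂ,
      star d ⬝ᵥ ∑ e with F.Incident e 𝔳, F.sign 𝔳 e • F.force Ψ 𝔳 e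
        + star r ⬝ᵥ ∑ e with F.Incident e 𝔳, F.sign 𝔳 e • F.moment Ψ 𝔳 e = 0 := by
    intro d r
    obtain ⟨Φ, hΦ, hΦ'⟩ := F.exists_inFormDomain_disp_rot 𝔳 d r
    have h1 := energy_eq_inner_add_sum hΦ.1 hΨ
    rw [h Φ hΦ, left_eq_add, sum_terminus_sub_origin, neg_eq_zero] at h1
    have h2 : ∀ 𝔴, ∑ e with F.Incident e 𝔴, F.sign 𝔴 e * F.work Φ Ψ 𝔴 e
        = star (if 𝔴 = 𝔳 then d else 0) ⬝ᵥ ∑ e with F.Incident e 𝔴, F.sign 𝔴 e • F.force Ψ 𝔴 e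
        + star (if 𝔴 = 𝔳 then r else 0) ⬝ᵥ
          ∑ e with F.Incident e 𝔴, F.sign 𝔴 e • F.moment Ψ 𝔴 e := fun 𝔴 => by
      rw [sum_sign_mul_work, sum_star_dotProduct_of_agree fun e he => (hΦ' 𝔴 e he).1,
        sum_star_dotProduct_of_agree fun e he => (hΦ' 𝔴 e he).2]
    by_cases hJ : 𝔳 ∈ F.joints
    · rw [Finset.sum_eq_single_of_mem 𝔳 hJ, h2, if_pos rfl, if_pos rfl] at h1
      · exact h1
      · intro 𝔴 _ hne
        rw [h2, if_neg hne, if_neg hne]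
        simp
    · have he : ∀ e, ¬F.Incident e 𝔳 := by
        rintro e (rfl | rfl)
        · exact hJ (Finset.mem_union_left _ (Finset.mem_image_of_mem _ (Finset.mem_univ e)))
        · exact hJ (Finset.mem_union_right _ (Finset.mem_image_of_mem _ (Finset.mem_univ e)))
      simp [he]
  constructor
  · have := key (∑ e with F.Incident e 𝔳, F.sign 𝔳 e • F.force Ψ 𝔳 e) 0
    rw [star_zero, zero_dotProduct, add_zero] at this
    exact eq_zero_of_star_dotProduct_self this
  · have := key 0 (∑ e with F.Incident e 𝔳, F.sign 𝔳 e • F.moment Ψ 𝔳 e)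
    rw [star_zero, zero_dotProduct, zero_add] at this
    exact eq_zero_of_star_dotProduct_self this

/-! ### Interior regularity -/

/-- The stiffnesses `a, b, c, d`, indexed like the components of a state. -/
def stiffness (F : Frame V E) : Fin 4 → E → ℝ := ![F.a, F.b, F.c, F.d]

/-- The orders of differentiation in the energy form. -/
def order : Fin 4 → ℕ := ![2, 2, 1, 1]

omit [Fintype E] in
theorem stiffness_pos (m : Fin 4) (e : E) : 0 < F.stiffness m e := by
  fin_cases m
  · exact F.a_pos e
  · exact F.b_pos e
  · exact F.c_pos e
  · exact F.d_pos e

theorem energy_eq_sum (Φ Ψ : F.State) : F.energy Φ Ψ = ∑ m, ∑ e, (F.stiffness m e : ℂ) *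
    ⟪wderivs (order m) (Φ m e), wderivs (order m) (Ψ m e)⟫_ℂ := by
  rw [Fin.sum_univ_four]
  simp only [← Finset.sum_add_distrib]
  rfl

omit [Fintype E] in
theorem forall_inH_order_iff {Ψ : F.State} : (∀ m, F.InH (order m) (Ψ m)) ↔
    F.InH 2 (Ψ 0) ∧ F.InH 2 (Ψ 1) ∧ F.InH 1 (Ψ 2) ∧ F.InH 1 (Ψ 3) :=
  ⟨fun h => ⟨h 0, h 1, h 2, h 3⟩, fun h m => by
    fin_cases m
    exacts [h.1, h.2.1, h.2.2.1, h.2.2.2]⟩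

open Classical in
/-- The state with the single component `f`, in position `m` on the edge `e`. -/
def single (F : Frame V E) (m : Fin 4) (e : E) (f : L2 (F.len e)) : F.State :=
  WithLp.toLp 2 (Pi.single m (WithLp.toLp 2 (Pi.single e f)))

omit [Fintype E] in
theorem single_apply_same (m : Fin 4) (e : E) (f : L2 (F.len e)) : F.single m e f m e = f := by
  simp [single]

omit [Fintype E] in
theorem single_apply_of_ne {m m' : Fin 4} {e e' : E} (f : L2 (F.len e)) (h : ¬(m' = m ∧ e' = e)) :
    F.single m e f m' e' = 0 := by
  classical
  by_cases hm : m' = m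
  · subst hm
    have he : e' ≠ e := fun he => h ⟨rfl, he⟩
    simp only [single, Pi.single_eq_same]
    exact Pi.single_eq_of_ne (M := fun e => L2 (F.len e)) he f
  · simp only [single]
    rw [Pi.single_eq_of_ne hm]
    rfl

theorem inFormDomain_single {m : Fin 4} {e : E} {f : L2 (F.len e)} (hf : MemH 2 f)
    (h0 : ∀ k < 2, ∀ x, x = 0 ∨ x = F.len e → endValue (wderivs k f) x = 0) :
    F.InFormDomain (F.single m e f) := by
  have hH : ∀ m', F.InH 2 (F.single m e f m') := fun m' e' => by
    by_cases h : m' = m ∧ e' = e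
    · obtain ⟨rfl, rfl⟩ := h
      rw [single_apply_same]; exact hf
    · rw [single_apply_of_ne f h]; exact memH_zero _
  have hval : ∀ k < 2, ∀ 𝔴 m' e', F.val 𝔴 k (F.single m e f m') e' = 0 := fun k hk 𝔴 m' e' => by
    by_cases h : m' = m ∧ e' = e
    · obtain ⟨rfl, rfl⟩ := h
      rw [val, single_apply_same]
      refine h0 k hk _ ?_
      unfold coord
      split_ifs <;> simp
    · have := congrFun (val_zero (F := F) 𝔴 k) e'
      rw [val, single_apply_of_ne f h]
      exact this
  refine ⟨⟨hH 0, hH 1, fun e => (hH 2 e).of_le one_le_two, fun e => (hH 3 e).of_le one_le_two⟩,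
    fun 𝔴 => ⟨fun e e' _ _ => ?_, fun e e' _ _ => ?_⟩⟩
  · simp only [hval 0 two_pos, zero_smul]
  · simp only [hval 0 two_pos, hval 1 one_lt_two, zero_smul]

theorem inner_single (m : Fin 4) (e : E) (f : L2 (F.len e)) (Θ : F.State) :
    ⟪F.single m e f, Θ⟫_ℂ = ⟪f, Θ m e⟫_ℂ := by
  rw [PiLp.inner_apply, Finset.sum_eq_single m, PiLp.inner_apply, Finset.sum_eq_single e,
    single_apply_same]
  · intro e' _ he
    rw [single_apply_of_ne f fun h => he h.2, inner_zero_left]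
  · simp
  · intro m' _ hm
    rw [PiLp.inner_apply]
    refine Finset.sum_eq_zero fun e' _ => ?_
    rw [single_apply_of_ne f fun h => hm h.1, inner_zero_left]
  · simp

theorem energy_single (m : Fin 4) (e : E) (f : L2 (F.len e)) (Ψ : F.State) :
    F.energy (F.single m e f) Ψ
      = F.stiffness m e * ⟪wderivs (order m) f, wderivs (order m) (Ψ m e)⟫_ℂ := by
  rw [energy_eq_sum, Finset.sum_eq_single m, Finset.sum_eq_single e, single_apply_same]
  · intro e' _ he
    rw [single_apply_of_ne f fun h => he h.2, wderivs_zero, inner_zero_left, mul_zero]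
  · simp
  · intro m' _ hm
    refine Finset.sum_eq_zero fun e' _ => ?_
    rw [single_apply_of_ne f fun h => hm h.1, wderivs_zero, inner_zero_left, mul_zero]
  · simp

/-- A state that represents the energy form on test functions solves the beam equations in the
interior of the edges, and has the regularity of the domain of the Hamiltonian. -/
theorem regular_of_energy_eq_inner {Ψ Θ : F.State} (hΨ : F.InFormDomain Ψ)
    (h : ∀ Φ, F.InFormDomain Φ → F.energy Φ Ψ = ⟪Φ, Θ⟫_ℂ) :
    (F.InH 4 (Ψ 0) ∧ F.InH 4 (Ψ 1) ∧ F.InH 2 (Ψ 2) ∧ F.InH 2 (Ψ 3)) ∧ F.action Ψ = Θ := by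
  have hs : ∀ m e, (F.stiffness m e : ℂ) ≠ 0 := fun m e =>
    Complex.ofReal_ne_zero.2 (stiffness_pos m e).ne'
  have htest : ∀ m e (φ : ℝ → ℝ) (hφ : IsTest (F.len e) φ),
      ⟪wderivs (order m) (ofCont (F.len e) hφ.toC), wderivs (order m) (Ψ m e)⟫_ℂ
        = ⟪ofCont (F.len e) hφ.toC, (F.stiffness m e : ℂ)⁻¹ • Θ m e⟫_ℂ := by
    intro m e φ hφ
    obtain ⟨h2, h1, -⟩ := hφ.isWeakDeriv.memH_two hφ.isTest_deriv.isWeakDeriv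
    have := h (F.single m e (ofCont (F.len e) hφ.toC)) (inFormDomain_single h2 fun k hk x hx => by
      obtain rfl | rfl : k = 0 ∨ k = 1 := by omega
      · exact hφ.endValue_toC (F.len_pos e) hx
      · rw [h1]; exact hφ.isTest_deriv.endValue_toC (F.len_pos e) hx)
    rw [inner_single, energy_single] at this
    rw [inner_smul_right, ← this, inv_mul_cancel_left₀ (hs m e)]
  have hbend : ∀ m, order m = 2 → ∀ e, MemH 2 (Ψ m e) →
      MemH 4 (Ψ m e) ∧ wderivs 4 (Ψ m e) = (F.stiffness m e : ℂ)⁻¹ • Θ m e := by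
    intro m hm e hH
    obtain ⟨g, hg, hgr⟩ := exists_isWeakDeriv_isWeakDeriv (F.len_pos e)
      (f := wderivs 2 (Ψ m e)) (r := (F.stiffness m e : ℂ)⁻¹ • Θ m e) fun φ hφ => by
        have := htest m e φ hφ
        rwa [hm, (hφ.isWeakDeriv.memH_two hφ.isTest_deriv.isWeakDeriv).2.2] at this
    obtain ⟨k2, -, k3⟩ := hg.memH_two hgr
    exact ⟨MemH.of_wderivs (n := 2) hH k2, by rw [← k3, wderivs_wderivs]⟩
  have hstretch : ∀ m, order m = 1 → ∀ e, MemH 1 (Ψ m e) →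
      MemH 2 (Ψ m e) ∧ wderivs 2 (Ψ m e) = -((F.stiffness m e : ℂ)⁻¹ • Θ m e) := by
    intro m hm e hH
    obtain ⟨k1, k2⟩ := IsWeakDeriv.memH_one (f := wderivs 1 (Ψ m e))
      (g := -((F.stiffness m e : ℂ)⁻¹ • Θ m e)) (isWeakDeriv_iff_inner.2 fun φ hφ => by
        have := htest m e φ hφ
        rw [hm, hφ.isWeakDeriv.memH_one.2] at this
        rw [this, inner_neg_right, neg_neg])
    exact ⟨MemH.of_wderivs (n := 1) hH k1, by rw [← k2, wderivs_wderivs]⟩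
  obtain ⟨⟨H0, H1, H2, H3⟩, -⟩ := hΨ
  refine ⟨⟨fun e => (hbend 0 rfl e (H0 e)).1, fun e => (hbend 1 rfl e (H1 e)).1,
    fun e => (hstretch 2 rfl e (H2 e)).1, fun e => (hstretch 3 rfl e (H3 e)).1⟩, ?_⟩
  ext m : 1
  refine WithLp.ofLp_injective 2 (funext fun e => ?_)
  have hb : ∀ m, order m = 2 → MemH 2 (Ψ m e) →
      (F.stiffness m e : ℂ) • wderivs 4 (Ψ m e) = Θ m e := fun m hm hH => by
    rw [(hbend m hm e hH).2, smul_inv_smul₀ (hs m e)]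
  have hst : ∀ m, order m = 1 → MemH 1 (Ψ m e) →
      -(F.stiffness m e : ℂ) • wderivs 2 (Ψ m e) = Θ m e := fun m hm hH => by
    rw [(hstretch m hm e hH).2, smul_neg, neg_smul, neg_neg, smul_inv_smul₀ (hs m e)]
  fin_cases m
  · exact hb 0 rfl (H0 e)
  · exact hb 1 rfl (H1 e)
  · exact hst 2 rfl (H2 e)
  · exact hst 3 rfl (H3 e)

/-- The operator of the energy form of a general frame: `Ψ` represents the form with right-hand
side `Θ` if and only if it has the regularity of `H⁴` and `H²`, satisfies the four vertex
conditions, and `Θ` is its edgewise action. -/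
theorem inFormDomain_and_energy_eq_inner_iff (Ψ Θ : F.State) :
    (F.InFormDomain Ψ ∧ ∀ Φ, F.InFormDomain Φ → F.energy Φ Ψ = ⟪Φ, Θ⟫_ℂ) ↔
      ((F.InH 4 (Ψ 0) ∧ F.InH 4 (Ψ 1) ∧ F.InH 2 (Ψ 2) ∧ F.InH 2 (Ψ 3)) ∧
        ∀ 𝔳, (F.DisplacementCont Ψ 𝔳 ∧ F.RotationCont Ψ 𝔳) ∧
          F.ForceBalance Ψ 𝔳 ∧ F.MomentBalance Ψ 𝔳) ∧ F.action Ψ = Θ := by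
  constructor
  · rintro ⟨hΨ, h⟩
    obtain ⟨hr, rfl⟩ := regular_of_energy_eq_inner hΨ h
    exact ⟨⟨hr, fun 𝔳 => ⟨hΨ.2 𝔳, balance_of_energy_eq_inner hr h 𝔳⟩⟩, rfl⟩
  · rintro ⟨⟨hr, hc⟩, rfl⟩
    exact ⟨⟨⟨fun e => (hr.1 e).of_le (by norm_num), fun e => (hr.2.1 e).of_le (by norm_num),
      fun e => (hr.2.2.1 e).of_le one_le_two, fun e => (hr.2.2.2 e).of_le one_le_two⟩,
      fun 𝔳 => (hc 𝔳).1⟩, fun Φ hΦ => energy_eq_inner hΦ hr fun 𝔳 => (hc 𝔳).2⟩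

/-! ### The energy form is closed -/

theorem val_add_of_inFormDomain {Φ Ψ : F.State} (hΦ : ∀ m, F.InH (order m) (Φ m))
    (hΨ : ∀ m, F.InH (order m) (Ψ m)) (m : Fin 4) {k : ℕ} (hk : k < order m) (𝔳 : V) (e : E) :
    F.val 𝔳 k ((Φ + Ψ) m) e = F.val 𝔳 k (Φ m) e + F.val 𝔳 k (Ψ m) e :=
  congrFun (val_add hk (hΦ m) (hΨ m) 𝔳) e

omit [Fintype E] in
theorem InFormDomain.inH {Ψ : F.State} (h : F.InFormDomain Ψ) (m : Fin 4) :
    F.InH (order m) (Ψ m) := forall_inH_order_iff.2 h.1 m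

omit [Fintype E] in
theorem inFormDomain_iff {Ψ : F.State} : F.InFormDomain Ψ ↔ (∀ m, F.InH (order m) (Ψ m)) ∧
    ∀ 𝔳, F.Agree 𝔳 (F.disp Ψ 𝔳) ∧ F.Agree 𝔳 (F.rot Ψ 𝔳) :=
  and_congr_left' forall_inH_order_iff.symm

theorem InFormDomain.add {Φ Ψ : F.State} (hΦ : F.InFormDomain Φ) (hΨ : F.InFormDomain Ψ) :
    F.InFormDomain (Φ + Ψ) := by
  have h := val_add_of_inFormDomain hΦ.inH hΨ.inH
  refine inFormDomain_iff.2 ⟨fun m => (hΦ.inH m).add (hΨ.inH m), fun 𝔳 => ⟨?_, ?_⟩⟩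
  · convert (inFormDomain_iff.1 hΦ).2 𝔳 |>.1.add ((inFormDomain_iff.1 hΨ).2 𝔳).1 using 1
    funext e
    simp only [disp, Pi.add_apply, h 0 two_pos, h 1 two_pos, h 2 one_pos]
    module
  · convert (inFormDomain_iff.1 hΦ).2 𝔳 |>.2.add ((inFormDomain_iff.1 hΨ).2 𝔳).2 using 1
    funext e
    simp only [rot, Pi.add_apply, h 0 one_lt_two, h 1 one_lt_two, h 3 one_pos]
    module

theorem InFormDomain.smul (z : ℂ) {Ψ : F.State} (hΨ : F.InFormDomain Ψ) :
    F.InFormDomain (z • Ψ) := by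
  have h : ∀ (m : Fin 4) {k : ℕ}, k < order m → ∀ (𝔳 : V) (e : E),
      F.val 𝔳 k ((z • Ψ) m) e = z * F.val 𝔳 k (Ψ m) e :=
    fun m _ hk 𝔳 e => congrFun (val_smul hk z (hΨ.inH m) 𝔳) e
  refine inFormDomain_iff.2 ⟨fun m => (hΨ.inH m).smul z, fun 𝔳 => ⟨?_, ?_⟩⟩
  · convert (inFormDomain_iff.1 hΨ).2 𝔳 |>.1.smul z using 1
    funext e
    simp only [disp, Pi.smul_apply, h 0 two_pos, h 1 two_pos, h 2 one_pos]
    module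
  · convert (inFormDomain_iff.1 hΨ).2 𝔳 |>.2.smul z using 1
    funext e
    simp only [rot, Pi.smul_apply, h 0 one_lt_two, h 1 one_lt_two, h 3 one_pos]
    module

theorem inFormDomain_zero : F.InFormDomain 0 :=
  inFormDomain_iff.2 ⟨fun _ => inH_zero, fun 𝔳 => by
    have h : ∀ (m : Fin 4) (k : ℕ) (e : E), F.val 𝔳 k ((0 : F.State) m) e = 0 :=
      fun _ k e => congrFun (val_zero 𝔳 k) e
    simp only [Agree, disp, rot, h, zero_smul, implies_true, and_self]⟩

/-- The strain operator `(v, w, u, η) ↦ (√a v'', √b w'', √c u', √d η')` on the form domain. The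
energy form is `⟪strain Φ, strain Ψ⟫`. -/
def strain (F : Frame V E) : F.State →ₗ.[ℂ] F.State where
  domain :=
    { carrier := {Ψ | F.InFormDomain Ψ}
      add_mem' := InFormDomain.add
      zero_mem' := inFormDomain_zero
      smul_mem' := fun z _ h => InFormDomain.smul z h }
  toFun :=
    { toFun := fun Ψ => WithLp.toLp 2 fun m => WithLp.toLp 2 fun e =>
        (√(F.stiffness m e) : ℂ) • wderivs (order m) ((Ψ : F.State) m e)
      map_add' := fun Φ Ψ => by
        ext m : 1
        refine WithLp.ofLp_injective 2 (funext fun e => ?_)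
        exact (congrArg _ (wderivs_add (InFormDomain.inH Φ.2 m e) (InFormDomain.inH Ψ.2 m e))).trans
          (smul_add _ _ _)
      map_smul' := fun z Ψ => by
        ext m : 1
        refine WithLp.ofLp_injective 2 (funext fun e => ?_)
        exact (congrArg _ (wderivs_smul z (InFormDomain.inH Ψ.2 m e))).trans (smul_comm _ _ _) }

theorem strain_apply (Ψ : F.strain.domain) (m : Fin 4) (e : E) : F.strain Ψ m e =
    (√(F.stiffness m e) : ℂ) • wderivs (order m) ((Ψ : F.State) m e) := rfl

theorem inner_strain (Φ Ψ : F.strain.domain) :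
    ⟪F.strain Φ, F.strain Ψ⟫_ℂ = F.energy (Φ : F.State) Ψ := by
  rw [energy_eq_sum, PiLp.inner_apply]
  refine Finset.sum_congr rfl fun m _ => ?_
  rw [PiLp.inner_apply]
  refine Finset.sum_congr rfl fun e _ => ?_
  rw [strain_apply, strain_apply, inner_smul_left, inner_smul_right, Complex.conj_ofReal,
    ← mul_assoc, ← Complex.ofReal_mul, Real.mul_self_sqrt (stiffness_pos m e).le]

omit [Fintype E] in
theorem Agree.of_tendsto {A : Type*} [TopologicalSpace A] [T2Space A] {ι : Type*} {L : Filter ι}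
    [L.NeBot] {𝔳 : V} {x : ι → E → A} {y : E → A} (hx : ∀ n, F.Agree 𝔳 (x n))
    (h : ∀ e, Tendsto (fun n => x n e) L (𝓝 (y e))) : F.Agree 𝔳 y := fun e e' he he' =>
  tendsto_nhds_unique (h e) ((h e').congr fun n => hx n e' e he' he)

/-- Limits in the graph norm stay in the form domain because the end values that enter the
vertex conditions converge. -/
theorem strain_isClosed (F : Frame V E) : F.strain.IsClosed := by
  refine IsSeqClosed.isClosed fun p q hp hpq => ?_
  have hp' : ∀ N, F.InFormDomain (p N).1 ∧ ∀ m e,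
      (p N).2 m e = (√(F.stiffness m e) : ℂ) • wderivs (order m) ((p N).1 m e) := fun N => by
    obtain ⟨Ψ, h1, h2⟩ := (LinearPMap.mem_graph_iff _).1 (hp N)
    rw [← h1, ← h2]
    exact ⟨Ψ.2, fun m e => strain_apply Ψ m e⟩
  have hs : ∀ m e, (√(F.stiffness m e) : ℂ) ≠ 0 := fun m e =>
    Complex.ofReal_ne_zero.2 (Real.sqrt_pos.2 (stiffness_pos m e)).ne'
  have hcomp : ∀ (m : Fin 4) (e : E), Continuous fun Ψ : F.State => Ψ m e := fun m e =>
    (PiLp.continuous_apply 2 _ e).comp (PiLp.continuous_apply 2 (fun _ : Fin 4 => F.Field) m)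
  have h1 : ∀ m e, Tendsto (fun N => (p N).1 m e) atTop (𝓝 (q.1 m e)) := fun m e =>
    ((hcomp m e).comp continuous_fst).continuousAt.tendsto.comp hpq
  have h2 : ∀ m e, Tendsto (fun N => wderivs (order m) ((p N).1 m e)) atTop
      (𝓝 ((√(F.stiffness m e) : ℂ)⁻¹ • q.2 m e)) := fun m e => by
    have := (((hcomp m e).comp continuous_snd).continuousAt.tendsto.comp hpq).const_smul
      (√(F.stiffness m e) : ℂ)⁻¹
    refine this.congr fun N => ?_
    simp only [Function.comp_apply]
    rw [(hp' N).2 m e, inv_smul_smul₀ (hs m e)]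
  have hcoord : ∀ (𝔳 : V) e, F.coord 𝔳 e = 0 ∨ F.coord 𝔳 e = F.len e := fun 𝔳 e => by
    unfold coord; split_ifs <;> simp
  have key : ∀ m e, (MemH (order m) (q.1 m e) ∧
      wderivs (order m) (q.1 m e) = (√(F.stiffness m e) : ℂ)⁻¹ • q.2 m e) ∧
      ∀ k < order m, ∀ 𝔳, Tendsto (fun N => F.val 𝔳 k ((p N).1 m) e) atTop
        (𝓝 (F.val 𝔳 k (q.1 m) e)) := fun m e => by
    have hH := fun N => (hp' N).1.inH m e
    have h2m := h2 m e
    have hm : order m = 2 ∨ order m = 1 := by fin_cases m <;> simp [order]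
    rcases hm with hm | hm
    · rw [hm] at hH h2m ⊢
      obtain ⟨k1, k2⟩ := MemH.of_tendsto_two (F.len_pos e) hH (h1 m e) h2m
      exact ⟨k1, fun k hk 𝔳 => k2 k hk _ (hcoord 𝔳 e)⟩
    · rw [hm] at hH h2m ⊢
      obtain ⟨k1, k2⟩ := MemH.of_tendsto_one (F.len_pos e) hH (h1 m e) h2m
      refine ⟨k1, fun k hk 𝔳 => ?_⟩
      obtain rfl : k = 0 := by omega
      exact k2 _ (hcoord 𝔳 e)
  have hq : F.InFormDomain q.1 := by
    refine inFormDomain_iff.2 ⟨fun m e => (key m e).1.1, fun 𝔳 => ⟨?_, ?_⟩⟩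
    · refine Agree.of_tendsto (L := atTop)
        (fun N => ((inFormDomain_iff.1 (hp' N).1).2 𝔳).1) fun e => ?_
      exact ((((key 2 e).2 0 one_pos 𝔳).smul_const _).add
        (((key 1 e).2 0 two_pos 𝔳).smul_const _)).add (((key 0 e).2 0 two_pos 𝔳).smul_const _)
    · refine Agree.of_tendsto (L := atTop)
        (fun N => ((inFormDomain_iff.1 (hp' N).1).2 𝔳).2) fun e => ?_
      exact ((((key 3 e).2 0 one_pos 𝔳).smul_const _).sub
        (((key 0 e).2 1 one_lt_two 𝔳).smul_const _)).add
        (((key 1 e).2 1 one_lt_two 𝔳).smul_const _)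
  refine (LinearPMap.mem_graph_iff _).2 ⟨⟨q.1, hq⟩, rfl, ?_⟩
  ext m : 1
  refine WithLp.ofLp_injective 2 (funext fun e => ?_)
  change (√(F.stiffness m e) : ℂ) • wderivs (order m) (q.1 m e) = q.2 m e
  rw [(key m e).1.2, smul_inv_smul₀ (hs m e)]

/-! ### The Hamiltonian of a planar frame -/

theorem isHamiltonian_iff_strain (H : F.State →ₗ.[ℂ] F.State) :
    F.IsHamiltonian H ↔ IsSelfAdjoint H ∧ ∀ Ψ : H.domain, ∃ hΨ : (Ψ : F.State) ∈ F.strain.domain,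
      ∀ Φ : F.strain.domain, ⟪F.strain Φ, F.strain ⟨Ψ, hΨ⟩⟫_ℂ = ⟪(Φ : F.State), H Ψ⟫_ℂ := by
  simp only [inner_strain]
  exact and_congr_right' ⟨fun h Ψ => ⟨h.1 Ψ, fun Φ => h.2 Φ Φ.2 Ψ⟩,
    fun h => ⟨fun Ψ => (h Ψ).1, fun Φ hΦ Ψ => (h Ψ).2 ⟨Φ, hΦ⟩⟩⟩

theorem split_symm_action (Ψ : F.State) :
    F.split.symm (WithLp.toLp 2 (F.action₁ (F.split Ψ).fst, F.action₂ (F.split Ψ).snd))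
      = F.action Ψ := by
  ext m : 1
  fin_cases m <;> rfl

theorem mem_graph_transport_split_iff (Ψ Θ : F.State) :
    (Ψ, Θ) ∈ (transport F.split (directSum F.H₁ F.H₂)).graph ↔
      (F.InDomain₁ (F.split Ψ).fst ∧ F.InDomain₂ (F.split Ψ).snd) ∧ F.action Ψ = Θ := by
  rw [LinearPMap.mem_graph_iff]
  constructor
  · rintro ⟨Φ, rfl, rfl⟩
    exact ⟨Φ.2, (split_symm_action _).symm⟩
  · rintro ⟨h, rfl⟩
    exact ⟨⟨Ψ, h⟩, rfl, split_symm_action Ψ⟩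

theorem IsPlanar.inDomain_split_iff {n : EuclideanSpace ℝ (Fin 3)} (h : F.IsPlanar n)
    (Ψ : F.State) : (F.InDomain₁ (F.split Ψ).fst ∧ F.InDomain₂ (F.split Ψ).snd) ↔
      (F.InH 4 (Ψ 0) ∧ F.InH 4 (Ψ 1) ∧ F.InH 2 (Ψ 2) ∧ F.InH 2 (Ψ 3)) ∧
        ∀ 𝔳, (F.DisplacementCont Ψ 𝔳 ∧ F.RotationCont Ψ 𝔳) ∧
          F.ForceBalance Ψ 𝔳 ∧ F.MomentBalance Ψ 𝔳 := by
  simp only [h.displacementCont_iff, h.rotationCont_iff, h.forceBalance_iff, h.momentBalance_iff]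
  constructor
  · rintro ⟨⟨⟨h0, h3⟩, k⟩, ⟨h1, h2⟩, l⟩
    exact ⟨⟨h0, h1, h2, h3⟩, fun 𝔳 => ⟨⟨⟨(k 𝔳).1.1, (l 𝔳).1.1⟩, (k 𝔳).1.2, (l 𝔳).1.2⟩,
      ⟨(k 𝔳).2.1, (l 𝔳).2.1⟩, (k 𝔳).2.2, (l 𝔳).2.2⟩⟩
  · rintro ⟨⟨h0, h1, h2, h3⟩, k⟩
    exact ⟨⟨⟨h0, h3⟩, fun 𝔳 => ⟨⟨(k 𝔳).1.1.1, (k 𝔳).1.2.1⟩, (k 𝔳).2.1.1, (k 𝔳).2.2.1⟩⟩,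
      ⟨h1, h2⟩, fun 𝔳 => ⟨⟨(k 𝔳).1.1.2, (k 𝔳).1.2.2⟩, (k 𝔳).2.1.2, (k 𝔳).2.2.2⟩⟩

theorem IsPlanar.isHamiltonian_iff {n : EuclideanSpace ℝ (Fin 3)} (h : F.IsPlanar n)
    (H : F.State →ₗ.[ℂ] F.State) :
    F.IsHamiltonian H ↔ H = transport F.split (directSum F.H₁ F.H₂) := by
  rw [isHamiltonian_iff_strain]
  refine isSelfAdjoint_and_form_iff_eq F.strain_isClosed (fun Ψ Θ => ?_) H
  rw [mem_graph_transport_split_iff, h.inDomain_split_iff, ← inFormDomain_and_energy_eq_inner_iff]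
  simp only [inner_strain]
  exact ⟨fun ⟨h1, h2⟩ => ⟨h1, fun Φ => h2 Φ Φ.2⟩, fun ⟨h1, h2⟩ => ⟨h1, fun Φ hΦ => h2 ⟨Φ, hΦ⟩⟩⟩

end Frame

end Beam

end

theorem corollary4p2 {V E : Type*} [Fintype E] (F : Beam.Frame V E)
    (n : EuclideanSpace ℝ (Fin 3)) (hplanar : F.IsPlanar n) :
    (∀ H : F.State →ₗ.[ℂ] F.State,
      F.IsHamiltonian H ↔ H = Beam.transport F.split (Beam.directSum F.H₁ F.H₂)) ∧
    (∀ Ψ : F.State,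
      F.InH 4 (Ψ 0) → F.InH 4 (Ψ 1) → F.InH 2 (Ψ 2) → F.InH 2 (Ψ 3) → ∀ 𝔳 : V,
      (F.DisplacementCont Ψ 𝔳 ↔
        F.DisplacementCont₁ (Ψ 0) 𝔳 ∧ F.DisplacementCont₂ (Ψ 1) (Ψ 2) 𝔳) ∧
      (F.RotationCont Ψ 𝔳 ↔ F.RotationCont₁ (Ψ 0) (Ψ 3) 𝔳 ∧ F.RotationCont₂ (Ψ 1) 𝔳) ∧
      (F.ForceBalance Ψ 𝔳 ↔ F.ForceBalance₁ (Ψ 0) 𝔳 ∧ F.ForceBalance₂ (Ψ 1) (Ψ 2) 𝔳) ∧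
      (F.MomentBalance Ψ 𝔳 ↔ F.MomentBalance₁ (Ψ 0) (Ψ 3) 𝔳 ∧ F.MomentBalance₂ (Ψ 1) 𝔳)) :=
  ⟨hplanar.isHamiltonian_iff, fun Ψ _ _ _ _ 𝔳 => ⟨hplanar.displacementCont_iff Ψ 𝔳,
    hplanar.rotationCont_iff Ψ 𝔳, hplanar.forceBalance_iff Ψ 𝔳, hplanar.momentBalance_iff Ψ 𝔳⟩⟩
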